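/- Let $0<c_1<c_2$ and let $\kappa:[0,\infty)\to[c_1,c_2]$ be locally Lipschitz. For $T,\ell_0>0$, functions $y_0,y_1$ on $[0,\ell_0]$ and a control $u$ on $[0,T]$, consider the debonding model for the front $\ell(t)$ and the displacement $y(t,x)$, $$\begin{cases}\partial_{tt}^2y-\partial_{xx}^2y=0, & 0<t<T,\ 0<x<\ell(t),\\ y(t,0)=u(t),\quad y(t,\ell(t))=0, & 0\le t\le T,\\ y(0,x)=y_0(x),\quad \partial_ty(0,x)=y_1(x), & 0\le x\le \ell_0,\end{cases}\tag{1}$$ together with Griffith's criterion $\ell(0)=\ell_0$ and, for $0<t\le T$, $$\ell'(t)\ge0,\qquad G(t)\le\kappa(\ell(t)),\qquad \ell'(t)\,[G(t)-\kappa(\ell(t))]=0,\qquad G(t):=\tfrac12\bigl(1-\ell'(t)^2\bigr)\bigl(\partial_xy(t,\ell(t))\bigr)^2.\tag{2}$$ A $C^1$-solution is a pair $(\ell,y)$ with $\ell\in C^1[0,T]$ and $y\in C^1(\{0\le t\le T,\ 0\le x\le\ell(t)\})$ that satisfies (1) and (2), the wave equation being understood in the weak sense. Let $\ell_0>0$ and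 $(y_0,y_1)\in(C^1\times C^0)[0,\ell_0]$ satisfy $$y_0(\ell_0)=0,\qquad y_1(\ell_0)=-\max\left[\frac{\frac12\bigl(y_1(\ell_0)-y_0'(\ell_0)\bigr)^2-\kappa(\ell_0)}{\frac12\bigl(y_1(\ell_0)-y_0'(\ell_0)\bigr)^2+\kappa(\ell_0)},\,0\right]y_0'(\ell_0).$$ The *initial branch* is the part of the front determined by these data alone: with $g(s):=\frac12(y_1-y_0')(-s)$ for $s\in[-\ell_0,0]$, it is the $C^1$ solution on $[0,t_*]$ of $$\lambda'(t)=\max\left[\frac{2g(t-\lambda(t))^2-\kappa(\lambda(t))}{2g(t-\lambda(t))^2+\kappa(\lambda(t))},\,0\right],\qquad \lambda(0)=\ell_0,$$ where $t_*>0$ is the time at which $\lambda(t_*)=t_*$. Put $\ell_*:=\lambda(t_*)=t_*$ and $\ell_*':=\lambda'(t_*)$. Then $t_*,\ell_*,\ell_*'$ are well defined (they exist and are unique), and the following holds. Let $T>0$, $\bar\ell_0>0$ and $(\bar y_0,\bar y_1)\in(C^1\times C^0)[0,\bar\ell_0]$ satisfy $$T>2\bar\ell_0,\qquad \begin{cases}\bar\ell_0\ge\ell_*&\text{if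 }\ell_*'=0,\\ \bar\ell_0>\ell_*&\text{otherwise,}\end{cases}\qquad \bar y_0(\bar\ell_0)=\bar y_1(\bar\ell_0)=0,\qquad \|\bar y_1+\bar y_0'\|_{L^\infty[0,\bar\ell_0]}^2\le2\,\kappa(\bar\ell_0).$$ Then there is a control $u\in C^1[0,T]$ for which (1)–(2) has a $C^1$-solution $(\ell,y)$ on $[0,T]$, this $C^1$-solution is unique, and it satisfies $$\ell(T)=\bar\ell_0,\qquad y(T,\cdot)=\bar y_0,\qquad \partial_ty(T,\cdot)=\bar y_1\quad\text{on }[0,\bar\ell_0].$$ -/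

import Mathlib

open Set MeasureTheory
open scoped ContDiff ENNReal

namespace Debonding

/-- The closed space-time region `{(t, x) | 0 ≤ t ≤ T, 0 ≤ x ≤ ℓ(t)}`. -/
def closedRegion (T : ℝ) (ℓ : ℝ → ℝ) : Set (ℝ × ℝ) :=
  {p | 0 ≤ p.1 ∧ p.1 ≤ T ∧ 0 ≤ p.2 ∧ p.2 ≤ ℓ p.1}

/-- The open space-time region `{(t, x) | 0 < t < T, 0 < x < ℓ(t)}`. -/
def openRegion (T : ℝ) (ℓ : ℝ → ℝ) : Set (ℝ × ℝ) :=
  {p | 0 < p.1 ∧ p.1 < T ∧ 0 < p.2 ∧ p.2 < ℓ p.1}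

/-- `∂ₜ y` on the closed region (one-sided at its boundary). -/
noncomputable def dt (T : ℝ) (ℓ : ℝ → ℝ) (y : ℝ × ℝ → ℝ) (p : ℝ × ℝ) : ℝ :=
  fderivWithin ℝ y (closedRegion T ℓ) p (1, 0)

/-- `∂ₓ y` on the closed region (one-sided at its boundary). -/
noncomputable def dx (T : ℝ) (ℓ : ℝ → ℝ) (y : ℝ × ℝ → ℝ) (p : ℝ × ℝ) : ℝ :=
  fderivWithin ℝ y (closedRegion T ℓ) p (0, 1)

/-- `∂ₜₜ y - ∂ₓₓ y = 0` in the weak sense on the open region, for a `C¹` function `y`. -/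
def IsWeakWave (T : ℝ) (ℓ : ℝ → ℝ) (y : ℝ × ℝ → ℝ) : Prop :=
  ∀ φ : ℝ × ℝ → ℝ, ContDiff ℝ ∞ φ → HasCompactSupport φ → tsupport φ ⊆ openRegion T ℓ →
    ∫ p in openRegion T ℓ,
      (dt T ℓ y p * fderiv ℝ φ p (1, 0) - dx T ℓ y p * fderiv ℝ φ p (0, 1)) = 0

/-- The dynamic energy release rate `½ (1 - ℓ'(t)²) (∂ₓ y (t, ℓ(t)))²`. -/
noncomputable def energyReleaseRate (T : ℝ) (ℓ : ℝ → ℝ) (y : ℝ × ℝ → ℝ) (t : ℝ) : ℝ :=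
  1 / 2 * (1 - derivWithin ℓ (Icc 0 T) t ^ 2) * dx T ℓ y (t, ℓ t) ^ 2

/-- `(ℓ, y)` is a `C¹` solution on `[0, T]` of the debonding model with toughness `κ`, initial data
`(ℓ₀, y₀, y₁)` and boundary control `u`: wave equation, boundary conditions, initial conditions,
and Griffith's criterion for the debonding front. -/
structure IsC1Solution (κ : ℝ → ℝ) (T ℓ₀ : ℝ) (y₀ y₁ u : ℝ → ℝ) (ℓ : ℝ → ℝ) (y : ℝ × ℝ → ℝ) :
    Prop where
  front_regular : ContDiffOn ℝ 1 ℓ (Icc 0 T)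
  disp_regular : ContDiffOn ℝ 1 y (closedRegion T ℓ)
  wave : IsWeakWave T ℓ y
  left_boundary : ∀ t ∈ Icc 0 T, y (t, 0) = u t
  front_boundary : ∀ t ∈ Icc 0 T, y (t, ℓ t) = 0
  initial_disp : ∀ x ∈ Icc 0 ℓ₀, y (0, x) = y₀ x
  initial_velocity : ∀ x ∈ Icc 0 ℓ₀, dt T ℓ y (0, x) = y₁ x
  front_initial : ℓ 0 = ℓ₀
  front_mono : ∀ t ∈ Ioc 0 T, 0 ≤ derivWithin ℓ (Icc 0 T) t
  griffith_le : ∀ t ∈ Ioc 0 T, energyReleaseRate T ℓ y t ≤ κ (ℓ t)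
  griffith_eq : ∀ t ∈ Ioc 0 T,
    derivWithin ℓ (Icc 0 T) t * (energyReleaseRate T ℓ y t - κ (ℓ t)) = 0

/-- The front speed `max [(2 a² - k) / (2 a² + k), 0]` that Griffith's criterion selects for an
incoming derivative `a` and a toughness `k`. -/
noncomputable def griffithSpeed (a k : ℝ) : ℝ :=
  max ((2 * a ^ 2 - k) / (2 * a ^ 2 + k)) 0

/-- The incoming derivative `f'(s) = ½ (y₁ - y₀')(-s)`, `s ∈ [-ℓ₀, 0]`, given by the initial
data. -/
noncomputable def incoming (ℓ₀ : ℝ) (y₀ y₁ : ℝ → ℝ) (s : ℝ) : ℝ :=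
  1 / 2 * (y₁ (-s) - derivWithin y₀ (Icc 0 ℓ₀) (-s))

/-- `lam` is the initial branch of the front, i.e. the part on `[0, tS]` that is determined by the
initial data alone; it ends at the time `tS` with `tS - lam tS = 0`. -/
structure IsInitialBranch (κ : ℝ → ℝ) (ℓ₀ : ℝ) (y₀ y₁ : ℝ → ℝ) (tS : ℝ) (lam : ℝ → ℝ) :
    Prop where
  time_pos : 0 < tS
  regular : ContDiffOn ℝ 1 lam (Icc 0 tS)
  initial : lam 0 = ℓ₀
  evolution : ∀ t ∈ Icc 0 tS,
    derivWithin lam (Icc 0 tS) t = griffithSpeed (incoming ℓ₀ y₀ y₁ (t - lam t)) (κ (lam t))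
  terminal : tS - lam tS = 0

/-- `(tS, ℓS, dS)` are the end time, the front position and the front speed at the end of the
initial branch. -/
def IsInitialBranchEnd (κ : ℝ → ℝ) (ℓ₀ : ℝ) (y₀ y₁ : ℝ → ℝ) (tS ℓS dS : ℝ) : Prop :=
  ∃ lam : ℝ → ℝ, IsInitialBranch κ ℓ₀ y₀ y₁ tS lam ∧ ℓS = lam tS ∧
    dS = derivWithin lam (Icc 0 tS) tS

end Debonding

/-! By d'Alembert, y = f(t - x) + g(t + x), and the incoming derivative F = f' governs everything.
The boundary condition at the front and Griffith's criterion combine into ℓ' = `griffithSpeed` (F(t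
- ℓ)) (κ(ℓ)). This speed is less than 1, so the emission coordinate s = t - ℓ(t) increases, and in
it the front L(s) solves dL/ds = max(F(s)²/κ(L) - 1/2, 0), where F enters only at s itself
(`FrontProfile`). Differentiating f(s) + g(s + 2L(s)) = 0 gives the reflected derivative H = g'. A
continuous F thus generates a solution, and the control is its trace at x = 0
(`WaveProfile.isC1Solution`).

The task is therefore to find F. The initial data fix it on [-ℓ₀, 0]. Let ℓbar be the target
position. If the front rests there from s = T - 2ℓbar on, the final data fix F on [T - 2ℓbar, T]:
the second half is still travelling towards the front at time T and is half of ybar₁ - ybar₀', while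
the first half has been reflected and is minus half of ybar₁ + ybar₀'. The halves match since ybar₁
vanishes at ℓbar, and the norm bound says F² ≤ κ(ℓbar)/2 on the first half, which is the threshold
below which the front does not move. As T > 2ℓbar, the gap (0, T - 2ℓbar) remains. There the slope P
= dL/ds ≥ 0 is chosen first, with the value left by the initial branch and with the integral
required to reach ℓbar, and F is recovered as τ√(κ(L)(P + 1/2)). Where P > 0 one needs |τ| = 1;
where P = 0 any |τ| ≤ 1 will do, which leaves room to join F continuously to both ends
(`FrontProfile.exists_extension`). A positive initial slope needs a positive integral, hence the
strict inequality for ℓbar in that case.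

For uniqueness, a weak C¹ solution transports ∂ₜy ∓ ∂ₓy along characteristics
(`const_along_characteristic`). Incoming data determine the front by a Grönwall argument
(`FrontProfile.eq_of_griffithSpeed`), the front determines the reflected wave, and the control turns
the latter into new incoming data. Each round trip gains at least 2ℓ₀, so finitely many cover [0, T]
(`WaveProfile.unique`). The same Grönwall argument makes the end of the initial branch well defined.
-/

namespace Debonding

open Filter Topology

/-! ### Directional weak derivatives -/

/-- A function that is continuous on an open set, times a continuous function compactly supported
in that set, is integrable. -/
lemma integrable_mul_of_tsupport_subset {U : Set (ℝ × ℝ)} (hU : IsOpen U) {w ρ : ℝ × ℝ → ℝ}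
    (hw : ContinuousOn w U) (hρ : Continuous ρ) (hc : HasCompactSupport ρ) (hs : tsupport ρ ⊆ U) :
    Integrable (fun q => w q * ρ q) := by
  refine Continuous.integrable_of_hasCompactSupport ?_ (hc.mul_left)
  refine continuous_of_tsupport fun x hx => ?_
  have hx' : x ∈ U := hs (tsupport_mul_subset_right hx)
  exact (hw.continuousAt (hU.mem_nhds hx')).mul hρ.continuousAt

lemma abs_integral_mul_sub_le {w ρ : ℝ × ℝ → ℝ} {c ε : ℝ} (hρ0 : ∀ q, 0 ≤ ρ q)
    (hρ : Integrable ρ) (hw : Integrable fun q => w q * ρ q)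
    (h : ∀ q, ρ q ≠ 0 → |w q - c| ≤ ε) :
    |(∫ q, w q * ρ q) - c * ∫ q, ρ q| ≤ ε * ∫ q, ρ q := by
  rw [← integral_const_mul, ← integral_sub hw (hρ.const_mul c), ← integral_const_mul]
  refine norm_integral_le_of_norm_le (f := fun q => w q * ρ q - c * ρ q) (hρ.const_mul ε) ?_
  refine Eventually.of_forall fun q => ?_
  by_cases hq : ρ q = 0
  · simp [hq]
  · rw [← sub_mul, Real.norm_eq_abs, abs_mul, abs_of_nonneg (hρ0 q)]
    exact mul_le_mul_of_nonneg_right (h q hq) (hρ0 q)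

/-- A smooth function that vanishes before `-r`, is constant after `r`, whose derivative is
nonnegative, and positive at `0`. -/
lemma exists_smooth_step {r : ℝ} (hr : 0 < r) :
    ∃ (b Γ : ℝ → ℝ) (c : ℝ), ContDiff ℝ ∞ b ∧ ContDiff ℝ ∞ Γ ∧ (∀ t, HasDerivAt Γ (b t) t) ∧
      (∀ t, 0 ≤ b t) ∧ 0 < b 0 ∧ (∀ t, r ≤ |t| → b t = 0) ∧ (∀ t ≤ -r, Γ t = 0) ∧
      ∀ t, r ≤ t → Γ t = c := by
  let b : ContDiffBump (0 : ℝ) := ⟨r / 2, r, by linarith, by linarith⟩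
  have hbz : ∀ t, r ≤ |t| → b t = 0 := fun t ht => b.zero_of_le_dist (by
    simpa [Real.dist_eq] using ht)
  have hder : ∀ t, HasDerivAt (fun t => ∫ τ in (-r)..t, b τ) (b t) t := fun t =>
    intervalIntegral.integral_hasDerivAt_right (b.continuous.intervalIntegrable _ _)
      (b.continuous.stronglyMeasurableAtFilter _ _) b.continuous.continuousAt
  refine ⟨b, fun t => ∫ τ in (-r)..t, b τ, ∫ τ in (-r)..r, b τ, b.contDiff, ?_, hder,
    fun t => b.nonneg, b.pos_of_mem_ball (by simp [b, hr]), hbz, fun t ht => ?_, fun t ht => ?_⟩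
  · rw [contDiff_infty_iff_deriv]
    refine ⟨fun t => (hder t).differentiableAt, ?_⟩
    rw [show deriv (fun t => ∫ τ in (-r)..t, b τ) = b from funext fun t => (hder t).deriv]
    exact b.contDiff
  · beta_reduce
    rw [intervalIntegral.integral_congr (g := fun _ => (0 : ℝ)), intervalIntegral.integral_zero]
    intro τ hτ
    rw [uIcc_of_ge ht] at hτ
    exact hbz τ (by rw [abs_of_nonpos] <;> linarith [hτ.2])
  · beta_reduce
    rw [← intervalIntegral.integral_add_adjacent_intervals (a := -r) (b := r) (c := t)
      (b.continuous.intervalIntegrable _ _) (b.continuous.intervalIntegrable _ _), add_eq_left,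
      intervalIntegral.integral_congr (g := fun _ => (0 : ℝ)), intervalIntegral.integral_zero]
    intro τ hτ
    rw [uIcc_of_le ht] at hτ
    exact hbz τ (hτ.1.trans (le_abs_self τ))

/-- A continuous function whose weak derivative in the direction `(1, e)` vanishes on an open set
takes the same value at the end points of every segment of that direction contained in the set. -/
lemma eq_of_weak_deriv_eq_zero {U : Set (ℝ × ℝ)} (hU : IsOpen U) {w : ℝ × ℝ → ℝ}
    (hw : ContinuousOn w U) {e : ℝ} (he : |e| ≤ 1)
    (hweak : ∀ φ : ℝ × ℝ → ℝ, ContDiff ℝ ∞ φ → HasCompactSupport φ → tsupport φ ⊆ U →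
      ∫ q, w q * fderiv ℝ φ q (1, e) = 0)
    {t₀ t₁ ξ : ℝ} (h01 : t₀ ≤ t₁) (hseg : ∀ t ∈ Icc t₀ t₁, (t, ξ + e * t) ∈ U) :
    w (t₀, ξ + e * t₀) = w (t₁, ξ + e * t₁) := by
  have hm0 := hseg t₀ (left_mem_Icc.2 h01)
  have hm1 := hseg t₁ (right_mem_Icc.2 h01)
  by_contra hne
  -- A third of the gap: comparing the two weighted averages will bound the gap by 2ε.
  set ε : ℝ := |w (t₀, ξ + e * t₀) - w (t₁, ξ + e * t₁)| / 3 with hε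
  have hε0 : 0 < ε := by
    have := abs_pos.2 (sub_ne_zero.2 hne)
    positivity
  obtain ⟨d0, hd0, hd0'⟩ := Metric.continuousAt_iff.1 (hw.continuousAt (hU.mem_nhds hm0)) ε hε0
  obtain ⟨d1, hd1, hd1'⟩ := Metric.continuousAt_iff.1 (hw.continuousAt (hU.mem_nhds hm1)) ε hε0
  obtain ⟨δ, hδ, hδU⟩ := (isCompact_Icc.image_of_continuousOn (s := Icc t₀ t₁)
    (f := fun t => (t, ξ + e * t)) (by fun_prop)).exists_cthickening_subset_open hU
    (by rintro _ ⟨t, ht, rfl⟩; exact hseg t ht)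
  -- Since |e| ≤ 1, a point within r of the segment both in time and transversally is within 2r of
  -- it in the sup metric.
  obtain ⟨r, hr, hr0, hr1, hrδ⟩ : ∃ r : ℝ, 0 < r ∧ 2 * r < d0 ∧ 2 * r < d1 ∧ 2 * r ≤ δ := by
    refine ⟨min (min d0 d1) δ / 3, by positivity, ?_, ?_, ?_⟩
    · linarith [min_le_left (min d0 d1) δ, min_le_left d0 d1, lt_min (lt_min hd0 hd1) hδ]
    · linarith [min_le_left (min d0 d1) δ, min_le_right d0 d1, lt_min (lt_min hd0 hd1) hδ]
    · linarith [min_le_right (min d0 d1) δ, lt_min (lt_min hd0 hd1) hδ]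
  obtain ⟨b, Γ, c, hb, hΓ, hΓb, hb0, hb00, hbz, hΓ0, hΓ1⟩ := exists_smooth_step hr
  have hnear : ∀ t t' x : ℝ, |t - t'| ≤ r → |x - e * t - ξ| ≤ r →
      dist (t, x) (t', ξ + e * t') ≤ 2 * r := by
    intro t t' x h1 h2
    rw [Prod.dist_eq, max_le_iff, Real.dist_eq, Real.dist_eq]
    refine ⟨by linarith, ?_⟩
    rw [show x - (ξ + e * t') = (x - e * t - ξ) + e * (t - t') by ring]
    refine (abs_add_le _ _).trans ?_
    have : |e * (t - t')| ≤ 1 * r := by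
      rw [abs_mul]; exact mul_le_mul he h1 (abs_nonneg _) zero_le_one
    linarith
  -- the two weights, concentrated at the end points
  let ρ : ℝ → ℝ × ℝ → ℝ := fun s q => b (q.2 - e * q.1 - ξ) * b (q.1 - s)
  have hρc : ∀ s, Continuous (ρ s) := fun s => by
    have := hb.continuous
    fun_prop
  have hρz : ∀ s q, ρ s q ≠ 0 → dist q (s, ξ + e * s) ≤ 2 * r := by
    intro s q hq
    have h1 : |q.1 - s| ≤ r := by
      by_contra hcon
      exact hq (by simp [ρ, hbz _ (not_le.1 hcon).le])
    have h2 : |q.2 - e * q.1 - ξ| ≤ r := by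
      by_contra hcon
      exact hq (by simp [ρ, hbz _ (not_le.1 hcon).le])
    exact hnear q.1 s q.2 h1 h2
  have hρt : ∀ s, tsupport (ρ s) ⊆ Metric.closedBall (s, ξ + e * s) (2 * r) := fun s =>
    closure_minimal (fun q hq => hρz s q hq) Metric.isClosed_closedBall
  have hρcs : ∀ s, HasCompactSupport (ρ s) := fun s =>
    (isCompact_closedBall _ _).of_isClosed_subset (isClosed_tsupport _) (hρt s)
  have hρU : ∀ s ∈ Icc t₀ t₁, tsupport (ρ s) ⊆ U := fun s hs q hq => hδU <|
    Metric.mem_cthickening_of_dist_le q (s, ξ + e * s) δ _ ⟨s, hs, rfl⟩ ((hρt s hq).trans hrδ)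
  have hρi : ∀ s, Integrable (ρ s) := fun s => (hρc s).integrable_of_hasCompactSupport (hρcs s)
  have hρn : ∀ s q, 0 ≤ ρ s q := fun s q => mul_nonneg (hb0 _) (hb0 _)
  have hwi : ∀ s ∈ Icc t₀ t₁, Integrable fun q => w q * ρ s q := fun s hs =>
    integrable_mul_of_tsupport_subset hU hw (hρc s) (hρcs s) (hρU s hs)
  -- The weights are translates of each other along (1, e), so they have equal mass.
  have hI : ∀ s s', ∫ q, ρ s q = ∫ q, ρ s' q := by
    intro s s'
    rw [← integral_sub_right_eq_self (ρ s') ((s - s', e * (s - s')) : ℝ × ℝ)]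
    refine integral_congr_ae (Eventually.of_forall fun q => ?_)
    simp only [ρ, Prod.fst_sub, Prod.snd_sub]
    congr 2 <;> ring
  have hIpos : 0 < ∫ q, ρ t₀ q := by
    refine (hρc t₀).integral_pos_of_hasCompactSupport_nonneg_nonzero (hρcs t₀) (hρn t₀)
      (x := (t₀, ξ + e * t₀)) ?_
    simp only [ρ, sub_self, add_sub_cancel_right]
    positivity
  -- the test function
  let φ : ℝ × ℝ → ℝ := fun q => b (q.2 - e * q.1 - ξ) * (Γ (q.1 - t₀) - Γ (q.1 - t₁))
  have hφ : ContDiff ℝ ∞ φ := by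
    refine (hb.comp (by fun_prop)).mul ((hΓ.comp (by fun_prop)).sub (hΓ.comp (by fun_prop)))
  have hφs : tsupport φ ⊆ Metric.cthickening δ ((fun t => (t, ξ + e * t)) '' Icc t₀ t₁) := by
    refine closure_minimal (fun q hq => ?_) Metric.isClosed_cthickening
    have h2 : |q.2 - e * q.1 - ξ| ≤ r := by
      by_contra hcon
      exact hq (by simp [φ, hbz _ (not_le.1 hcon).le])
    -- Earlier than t₀ - r both primitives vanish; later than t₁ + r both equal c and cancel.
    have h3 : t₀ - r ≤ q.1 := by
      by_contra hcon
      exact hq (by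
        simp only [φ]
        rw [hΓ0 _ (by linarith), hΓ0 _ (by linarith)]; simp)
    have h4 : q.1 ≤ t₁ + r := by
      by_contra hcon
      exact hq (by
        simp only [φ]
        rw [hΓ1 _ (by linarith), hΓ1 _ (by linarith)]; simp)
    obtain ⟨t', ht', hd⟩ : ∃ t' ∈ Icc t₀ t₁, |q.1 - t'| ≤ r := by
      rcases le_total q.1 t₀ with h | h
      · exact ⟨t₀, left_mem_Icc.2 h01, by rw [abs_le]; constructor <;> linarith⟩
      rcases le_total q.1 t₁ with h' | h'
      · exact ⟨q.1, ⟨h, h'⟩, by simp [hr.le]⟩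
      · exact ⟨t₁, right_mem_Icc.2 h01, by rw [abs_le]; constructor <;> linarith⟩
    exact Metric.mem_cthickening_of_dist_le q (t', ξ + e * t') δ _ ⟨t', ht', rfl⟩
      ((hnear q.1 t' q.2 hd h2).trans hrδ)
  have hφc : HasCompactSupport φ :=
    ((isCompact_Icc.image (by fun_prop)).cthickening).of_isClosed_subset (isClosed_tsupport _) hφs
  -- The transverse factor of φ is constant in the direction (1, e), so only the primitives Γ are
  -- differentiated.
  have hφd : ∀ q, fderiv ℝ φ q (1, e) = ρ t₀ q - ρ t₁ q := by
    intro q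
    have hline : HasDerivAt (fun s : ℝ => φ (q + s • ((1, e) : ℝ × ℝ)))
        (b (q.2 - e * q.1 - ξ) * (b (q.1 - t₀) - b (q.1 - t₁))) 0 := by
      have h1 : ∀ s : ℝ, φ (q + s • ((1, e) : ℝ × ℝ)) =
          b (q.2 - e * q.1 - ξ) * (Γ (q.1 + s - t₀) - Γ (q.1 + s - t₁)) := by
        intro s
        simp only [φ, Prod.fst_add, Prod.snd_add, Prod.smul_fst, Prod.smul_snd, smul_eq_mul,
          mul_one]
        congr 2
        ring
      simp only [h1]
      have h2 : ∀ a : ℝ, HasDerivAt (fun s : ℝ => Γ (q.1 + s - a)) (b (q.1 - a)) 0 := by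
        intro a
        have h3 : HasDerivAt (fun s : ℝ => q.1 + s - a) 1 0 := by
          simpa using ((hasDerivAt_id (0 : ℝ)).const_add q.1).sub_const a
        have h4 : HasDerivAt Γ (b (q.1 - a)) (q.1 + 0 - a) := by
          simpa using hΓb (q.1 - a)
        simpa [Function.comp_def] using h4.comp (0 : ℝ) h3
      exact ((h2 t₀).sub (h2 t₁)).const_mul _
    have hf : HasFDerivAt φ (fderiv ℝ φ q) q :=
      (hφ.differentiable (by simp) q).hasFDerivAt
    have := HasDerivAt.unique (hf.hasLineDerivAt (1, e)) hline
    rw [this]; simp only [ρ]; ring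
  have hzero := hweak φ hφ hφc (hφs.trans hδU)
  simp only [hφd, mul_sub] at hzero
  rw [integral_sub (hwi _ (left_mem_Icc.2 h01)) (hwi _ (right_mem_Icc.2 h01))] at hzero
  have e0 := abs_integral_mul_sub_le (c := w (t₀, ξ + e * t₀)) (ε := ε) (hρn t₀) (hρi t₀)
    (hwi _ (left_mem_Icc.2 h01)) fun q hq => (hd0' ((hρz _ q hq).trans_lt hr0)).le
  have e1 := abs_integral_mul_sub_le (c := w (t₁, ξ + e * t₁)) (ε := ε) (hρn t₁) (hρi t₁)
    (hwi _ (right_mem_Icc.2 h01)) fun q hq => (hd1' ((hρz _ q hq).trans_lt hr1)).le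
  rw [hI t₁ t₀] at e1
  set I := ∫ q, ρ t₀ q
  have h3 : |w (t₀, ξ + e * t₀) - w (t₁, ξ + e * t₁)| * I ≤ 2 * ε * I := by
    rw [← abs_of_pos hIpos, ← abs_mul, abs_of_pos hIpos]
    rw [abs_le] at e0 e1 ⊢
    constructor <;> nlinarith [e0.1, e0.2, e1.1, e1.2]
  have h4 := le_of_mul_le_mul_right h3 hIpos
  linarith

/-! ### Weak solutions of the wave equation and characteristics -/

/-- The mixed second derivatives of a `C¹` function agree in the weak sense. -/
lemma integral_fderiv_mul_fderiv_comm {U : Set (ℝ × ℝ)} (hU : IsOpen U) {y : ℝ × ℝ → ℝ}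
    (hy : ContDiffOn ℝ 1 y U) {φ : ℝ × ℝ → ℝ} (hφ : ContDiff ℝ ∞ φ) (hc : HasCompactSupport φ)
    (hs : tsupport φ ⊆ U) (v u : ℝ × ℝ) :
    ∫ q, fderiv ℝ y q v * fderiv ℝ φ q u = ∫ q, fderiv ℝ y q u * fderiv ℝ φ q v := by
  have hdy : ContinuousOn (fderiv ℝ y) U := hy.continuousOn_fderiv_of_isOpen hU le_rfl
  have hφ' : ContDiff ℝ ∞ (fderiv ℝ φ) := hφ.fderiv_right (by simp)
  -- Integration by parts puts both derivatives on φ, where they commute.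
  have key : ∀ v u : ℝ × ℝ, ∫ q, y q * fderiv ℝ (fderiv ℝ φ) q v u =
      -∫ q, fderiv ℝ y q v * fderiv ℝ φ q u := by
    intro v u
    have hg : ContDiff ℝ ∞ fun q => fderiv ℝ φ q u := hφ'.clm_apply contDiff_const
    have hsub : tsupport (fun q => fderiv ℝ φ q u) ⊆ tsupport φ :=
        tsupport_fderiv_apply_subset ℝ u
    have hcs : HasCompactSupport fun q => fderiv ℝ φ q u :=
      IsCompact.of_isClosed_subset hc (isClosed_tsupport _) hsub
    have hg' : Continuous fun q => fderiv ℝ (fderiv ℝ φ) q v u :=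
      ((hφ'.continuous_fderiv (by simp)).clm_apply continuous_const).clm_apply continuous_const
    have hsub' : tsupport (fun q => fderiv ℝ (fderiv ℝ φ) q v u) ⊆ tsupport φ := by
      refine closure_minimal (fun q hq => ?_) (isClosed_tsupport φ)
      by_contra hcon
      refine hq ?_
      have : fderiv ℝ (fderiv ℝ φ) q = 0 := by
        by_contra h
        exact hcon (tsupport_fderiv_subset ℝ (support_fderiv_subset ℝ h))
      simp [this]
    have hcs' : HasCompactSupport fun q => fderiv ℝ (fderiv ℝ φ) q v u :=
      IsCompact.of_isClosed_subset hc (isClosed_tsupport _) hsub'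
    refine integral_bilinear_hasLineDerivAt_right_eq_neg_left_of_integrable (v := v)
      (B := ContinuousLinearMap.mul ℝ ℝ) (f := y) (f' := fun q => fderiv ℝ y q v)
      (g := fun q => fderiv ℝ φ q u) (g' := fun q => fderiv ℝ (fderiv ℝ φ) q v u)
      ?_ ?_ ?_ ?_ ?_
    · exact integrable_mul_of_tsupport_subset hU (hdy.clm_apply continuousOn_const) hg.continuous
        hcs (hsub.trans hs)
    · exact integrable_mul_of_tsupport_subset hU hy.continuousOn hg' hcs' (hsub'.trans hs)
    · exact integrable_mul_of_tsupport_subset hU hy.continuousOn hg.continuous hcs (hsub.trans hs)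
    · intro q hq
      exact (((hy.differentiableOn (by simp)).differentiableAt
        (hU.mem_nhds (hs (hsub hq)))).hasFDerivAt).hasLineDerivAt v
    · intro q _
      have h1 : HasFDerivAt (fderiv ℝ φ) (fderiv ℝ (fderiv ℝ φ) q) q :=
        (hφ'.differentiable (by simp) q).hasFDerivAt
      have h2 := (h1.clm_apply (hasFDerivAt_const u q)).hasLineDerivAt v
      simpa using h2
  have hsymm : ∀ q, fderiv ℝ (fderiv ℝ φ) q v u = fderiv ℝ (fderiv ℝ φ) q u v := fun q =>
    (hφ.contDiffAt (x := q)).isSymmSndFDerivAt (by simpa using ENat.LEInfty.out) v u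
  have h1 := key v u
  have h2 := key u v
  simp only [hsymm] at h1
  linarith

section Region

variable {T : ℝ} {ℓ : ℝ → ℝ} {y : ℝ × ℝ → ℝ}

lemma isOpen_openRegion (hℓ : ContinuousOn ℓ (Icc 0 T)) : IsOpen (openRegion T ℓ) := by
  have h1 : ContinuousOn (fun p : ℝ × ℝ => ℓ p.1 - p.2) (Prod.fst ⁻¹' Ioo 0 T) := by
    refine ContinuousOn.sub (hℓ.comp continuousOn_fst fun p hp => Ioo_subset_Icc_self hp) ?_
    exact continuousOn_snd
  have h2 := h1.isOpen_inter_preimage (isOpen_Ioo.preimage continuous_fst) (isOpen_Ioi (a := 0))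
  have h3 : openRegion T ℓ = (Prod.fst ⁻¹' Ioo 0 T ∩ (fun p : ℝ × ℝ => ℓ p.1 - p.2) ⁻¹' Ioi 0) ∩
      {p | 0 < p.2} := by
    ext p
    simp only [openRegion, mem_ofPred_eq, mem_inter_iff, mem_preimage, mem_Ioo, mem_Ioi, sub_pos]
    tauto
  rw [h3]
  exact h2.inter (isOpen_lt continuous_const continuous_snd)

lemma openRegion_subset_closedRegion : openRegion T ℓ ⊆ closedRegion T ℓ :=
  fun _ hp => ⟨hp.1.le, hp.2.1.le, hp.2.2.1.le, hp.2.2.2.le⟩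

/-- The speed is bounded on the compact interval. At the final time there is no later slice to use,
and the convex set under this cone shows that the region has interior near the points of that slice.
-/
lemma exists_lower_cone (hT : 0 < T) (hℓ : ContDiffOn ℝ 1 ℓ (Icc 0 T)) :
    ∃ M, 0 ≤ M ∧ ∀ s ∈ Icc 0 T, ℓ T - M * (T - s) ≤ ℓ s := by
  have hu := uniqueDiffOn_Icc hT
  obtain ⟨M, hM⟩ := isCompact_Icc.exists_bound_of_continuousOn
    (hℓ.continuousOn_derivWithin hu le_rfl)
  refine ⟨M, (norm_nonneg _).trans (hM T (right_mem_Icc.2 hT.le)), fun s hs => ?_⟩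
  have := Convex.norm_image_sub_le_of_norm_derivWithin_le (hℓ.differentiableOn (by simp))
    hM (convex_Icc 0 T) hs (right_mem_Icc.2 hT.le)
  rw [Real.norm_eq_abs, Real.norm_eq_abs, abs_of_nonneg (sub_nonneg.2 hs.2)] at this
  linarith [le_abs_self (ℓ T - ℓ s)]

/-- The closed region below a nondecreasing positive `C¹` front has unique derivatives. -/
lemma uniqueDiffOn_closedRegion (hT : 0 < T) (hℓ : ContDiffOn ℝ 1 ℓ (Icc 0 T))
    (hmono : MonotoneOn ℓ (Icc 0 T)) (hpos : 0 < ℓ 0) :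
    UniqueDiffOn ℝ (closedRegion T ℓ) := by
  rintro ⟨t, x⟩ ⟨ht0, htT, hx0, hxℓ⟩
  simp only at ht0 htT hx0 hxℓ
  -- Before the final time, monotonicity of the front puts a rectangle extending forward in time
  -- inside the region; at the final time the truncated cone replaces it.
  rcases htT.lt_or_eq with htT | rfl
  · have hsub : Icc t T ×ˢ Icc 0 (ℓ t) ⊆ closedRegion T ℓ := by
      rintro ⟨s, z⟩ ⟨hs, hz⟩
      exact ⟨ht0.trans hs.1, hs.2, hz.1,
        hz.2.trans (hmono ⟨ht0, htT.le⟩ ⟨ht0.trans hs.1, hs.2⟩ hs.1)⟩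
    refine UniqueDiffWithinAt.mono (uniqueDiffWithinAt_convex
      ((convex_Icc t T).prod (convex_Icc 0 (ℓ t))) ?_ (subset_closure ?_)) hsub
    · have hℓt : 0 < ℓ t := hpos.trans_le (hmono ⟨le_rfl, hT.le⟩ ⟨ht0, htT.le⟩ ht0)
      rw [interior_prod_eq, interior_Icc, interior_Icc]
      exact (nonempty_Ioo.2 htT).prod (nonempty_Ioo.2 hℓt)
    · exact ⟨⟨le_rfl, htT.le⟩, hx0, hxℓ⟩
  · obtain ⟨M, hM0, hM⟩ := exists_lower_cone hT hℓ
    let C : Set (ℝ × ℝ) := {p | 0 ≤ p.1 ∧ p.1 ≤ t ∧ 0 ≤ p.2 ∧ p.2 + M * (t - p.1) ≤ ℓ t}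
    have hsub : C ⊆ closedRegion t ℓ := by
      rintro ⟨s, z⟩ ⟨h1, h2, h3, h4⟩
      exact ⟨h1, h2, h3, by have := hM s ⟨h1, h2⟩; simp only at h4 ⊢; linarith⟩
    have hℓT : 0 < ℓ t := hpos.trans_le (hmono ⟨le_rfl, hT.le⟩ ⟨hT.le, le_rfl⟩ hT.le)
    refine UniqueDiffWithinAt.mono (uniqueDiffWithinAt_convex ?_ ?_ (subset_closure ?_)) hsub
    · rintro ⟨s, z⟩ ⟨h1, h2, h3, h4⟩ ⟨s', z'⟩ ⟨h1', h2', h3', h4'⟩ a b ha hb hab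
      simp only at h1 h2 h3 h4 h1' h2' h3' h4'
      refine ⟨?_, ?_, ?_, ?_⟩ <;> simp only [Prod.smul_mk, Prod.mk_add_mk, smul_eq_mul]
      · positivity
      · nlinarith
      · positivity
      · have e1 := mul_le_mul_of_nonneg_left h4 ha
        have e2 := mul_le_mul_of_nonneg_left h4' hb
        have e3 : a * z + b * z' + M * (t - (a * s + b * s')) =
          a * (z + M * (t - s)) + b * (z' + M * (t - s')) + M * t * (1 - (a + b)) := by ring
        have e4 : a * ℓ t + b * ℓ t = ℓ t := by rw [← add_mul, hab, one_mul]
        rw [e3, hab]; linarith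
    · have hO : IsOpen {p : ℝ × ℝ | 0 < p.1 ∧ p.1 < t ∧ 0 < p.2 ∧ p.2 + M * (t - p.1) < ℓ t} := by
        refine (isOpen_lt continuous_const continuous_fst).inter
          ((isOpen_lt continuous_fst continuous_const).inter
          ((isOpen_lt continuous_const continuous_snd).inter
          (isOpen_lt (continuous_snd.add
            (continuous_const.mul (continuous_const.sub continuous_fst))) continuous_const)))
      obtain ⟨δ, hδ0, hδt, hδ⟩ : ∃ δ, 0 < δ ∧ δ < t ∧ M * δ < ℓ t / 2 := by
        refine ⟨min (t / 2) (ℓ t / 2 / (M + 1) / 2), by positivity, ?_, ?_⟩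
        · exact (min_le_left _ _).trans_lt (by linarith)
        · calc M * min (t / 2) (ℓ t / 2 / (M + 1) / 2)
              ≤ (M + 1) * (ℓ t / 2 / (M + 1) / 2) :=
                mul_le_mul (by linarith) (min_le_right _ _) (by positivity) (by positivity)
            _ = ℓ t / 4 := by field_simp; norm_num
            _ < ℓ t / 2 := by linarith
      refine ⟨(t - δ, ℓ t / 2), interior_maximal (fun p hp => ?_) hO ⟨?_, ?_, ?_, ?_⟩⟩
      · exact ⟨hp.1.le, hp.2.1.le, hp.2.2.1.le, hp.2.2.2.le⟩
      all_goals simp only [sub_sub_cancel]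
      all_goals linarith
    · exact ⟨ht0, le_rfl, hx0, by simpa using hxℓ⟩

lemma fderivWithin_eq_fderiv_of_mem_openRegion (hℓ : ContinuousOn ℓ (Icc 0 T)) {p : ℝ × ℝ}
    (hp : p ∈ openRegion T ℓ) : fderivWithin ℝ y (closedRegion T ℓ) p = fderiv ℝ y p :=
  fderivWithin_of_mem_nhds (mem_of_superset ((isOpen_openRegion hℓ).mem_nhds hp)
    openRegion_subset_closedRegion)

/-- A `C¹` weak solution of the wave equation: the derivative `∂ₜ y - e ∂ₓ y`, `e = ±1`, is constant
along segments of direction `(1, e)` that are contained in the open region up to end points. -/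
lemma const_along_characteristic (hℓ : ContinuousOn ℓ (Icc 0 T))
    (hu : UniqueDiffOn ℝ (closedRegion T ℓ)) (hy : ContDiffOn ℝ 1 y (closedRegion T ℓ))
    (hwave : IsWeakWave T ℓ y) {e : ℝ} (he : e ^ 2 = 1) {t₀ t₁ ξ : ℝ} (h01 : t₀ ≤ t₁)
    (h0 : (t₀, ξ + e * t₀) ∈ closedRegion T ℓ) (h1 : (t₁, ξ + e * t₁) ∈ closedRegion T ℓ)
    (hseg : ∀ t ∈ Ioo t₀ t₁, (t, ξ + e * t) ∈ openRegion T ℓ) :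
    dt T ℓ y (t₀, ξ + e * t₀) - e * dx T ℓ y (t₀, ξ + e * t₀) =
      dt T ℓ y (t₁, ξ + e * t₁) - e * dx T ℓ y (t₁, ξ + e * t₁) := by
  rcases h01.eq_or_lt with rfl | h01
  · rfl
  have hO := isOpen_openRegion hℓ
  have hyO : ContDiffOn ℝ 1 y (openRegion T ℓ) := hy.mono openRegion_subset_closedRegion
  have hcont : ContinuousOn (fun q => dt T ℓ y q - e * dx T ℓ y q) (closedRegion T ℓ) := by
    have := hy.continuousOn_fderivWithin hu le_rfl
    exact (this.clm_apply continuousOn_const).sub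
      (continuousOn_const.mul (this.clm_apply continuousOn_const))
  -- As e² = 1, the product of (∂ₜ - e∂ₓ)y and (∂ₜ + e∂ₓ)φ is the integrand of the weak wave
  -- equation plus e times a difference of mixed products, whose integral vanishes.
  have hweak : ∀ φ : ℝ × ℝ → ℝ, ContDiff ℝ ∞ φ → HasCompactSupport φ →
      tsupport φ ⊆ openRegion T ℓ →
      ∫ q, (dt T ℓ y q - e * dx T ℓ y q) * fderiv ℝ φ q (1, e) = 0 := by
    intro φ hφ hc hs
    have hφ' : Continuous (fderiv ℝ φ) := hφ.continuous_fderiv (by simp)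
    have hdy : ContinuousOn (fderiv ℝ y) (openRegion T ℓ) :=
      hyO.continuousOn_fderiv_of_isOpen hO le_rfl
    have hzero : ∀ q, q ∉ openRegion T ℓ → fderiv ℝ φ q = 0 := by
      intro q hq
      by_contra h
      exact hq (hs (support_fderiv_subset ℝ h))
    have hint : ∀ v u : ℝ × ℝ, Integrable fun q => fderiv ℝ y q v * fderiv ℝ φ q u := by
      intro v u
      have hsub : tsupport (fun q => fderiv ℝ φ q u) ⊆ tsupport φ :=
        tsupport_fderiv_apply_subset ℝ u
      exact integrable_mul_of_tsupport_subset hO (hdy.clm_apply continuousOn_const)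
        (hφ'.clm_apply continuous_const)
        (IsCompact.of_isClosed_subset hc (isClosed_tsupport _) hsub) (hsub.trans hs)
    have hw := hwave φ hφ hc hs
    have hw' : ∫ q, (fderiv ℝ y q (1, 0) * fderiv ℝ φ q (1, 0) -
        fderiv ℝ y q (0, 1) * fderiv ℝ φ q (0, 1)) = 0 := by
      refine Eq.trans ?_ hw
      rw [← integral_indicator hO.measurableSet]
      refine integral_congr_ae (Eventually.of_forall fun q => ?_)
      by_cases hq : q ∈ openRegion T ℓ
      · simp [hq, dt, dx, fderivWithin_eq_fderiv_of_mem_openRegion hℓ hq]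
      · simp [hq, hzero q hq]
    have hcomm := integral_fderiv_mul_fderiv_comm hO hyO hφ hc hs (1, 0) (0, 1)
    calc ∫ q, (dt T ℓ y q - e * dx T ℓ y q) * fderiv ℝ φ q (1, e)
        = ∫ q, ((fderiv ℝ y q (1, 0) * fderiv ℝ φ q (1, 0) -
            fderiv ℝ y q (0, 1) * fderiv ℝ φ q (0, 1)) +
            e * (fderiv ℝ y q (1, 0) * fderiv ℝ φ q (0, 1) -
            fderiv ℝ y q (0, 1) * fderiv ℝ φ q (1, 0))) := by
          refine integral_congr_ae (Eventually.of_forall fun q => ?_)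
          have hsplit : fderiv ℝ φ q (1, e) = fderiv ℝ φ q (1, 0) + e * fderiv ℝ φ q (0, 1) := by
            rw [show ((1, e) : ℝ × ℝ) = (1, 0) + e • (0, 1) by simp, map_add, map_smul, smul_eq_mul]
          by_cases hq : q ∈ openRegion T ℓ
          · simp only [dt, dx, fderivWithin_eq_fderiv_of_mem_openRegion hℓ hq, hsplit]
            linear_combination (-fderiv ℝ y q (0, 1) * fderiv ℝ φ q (0, 1)) * he
          · simp [hzero q hq]
      _ = 0 := by
          rw [integral_add ?_ ?_, hw', integral_const_mul,
            integral_sub (hint _ _) (hint _ _), hcomm]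
          · ring
          · exact (hint _ _).sub (hint _ _)
          · exact ((hint _ _).sub (hint _ _)).const_mul e
  have he1 : |e| ≤ 1 := by rw [← sq_le_one_iff_abs_le_one, he]
  set f : ℝ → ℝ := fun t => dt T ℓ y (t, ξ + e * t) - e * dx T ℓ y (t, ξ + e * t) with hf
  have hfc : ContinuousOn f (Icc t₀ t₁) := by
    refine hcont.comp (f := fun t => (t, ξ + e * t)) (by fun_prop) fun t ht => ?_
    rcases ht.1.eq_or_lt with rfl | h
    · exact h0
    rcases ht.2.eq_or_lt with rfl | h'
    · exact h1
    exact openRegion_subset_closedRegion (hseg t ⟨h, h'⟩)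
  have hmid : (t₀ + t₁) / 2 ∈ Ioo t₀ t₁ := ⟨by linarith, by linarith⟩
  -- The end points may lie on the boundary of the region, so constancy is shown on the open
  -- interval and extended by continuity.
  have hEq : EqOn f (fun _ => f ((t₀ + t₁) / 2)) (Ioo t₀ t₁) := by
    intro t ht
    rcases le_total t ((t₀ + t₁) / 2) with h | h
    · exact eq_of_weak_deriv_eq_zero hO (hcont.mono openRegion_subset_closedRegion) he1 hweak h
        fun s hs => hseg s ⟨ht.1.trans_le hs.1, hs.2.trans_lt hmid.2⟩
    · exact (eq_of_weak_deriv_eq_zero hO (hcont.mono openRegion_subset_closedRegion) he1 hweak h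
        fun s hs => hseg s ⟨hmid.1.trans_le hs.1, hs.2.trans_lt ht.2⟩).symm
  have hEq' := hEq.of_subset_closure hfc continuousOn_const Ioo_subset_Icc_self
    (by rw [closure_Ioo h01.ne])
  exact (hEq' (left_mem_Icc.2 h01.le)).trans (hEq' (right_mem_Icc.2 h01.le)).symm

end Region

/-! ### Properties of `C¹` solutions -/

lemma griffithSpeed_nonneg (a k : ℝ) : 0 ≤ griffithSpeed a k := le_max_right _ _

lemma griffithSpeed_lt_one (a : ℝ) {k : ℝ} (hk : 0 < k) : griffithSpeed a k < 1 := by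
  rw [griffithSpeed, max_lt_iff]
  refine ⟨?_, one_pos⟩
  rw [div_lt_one (by positivity)]
  linarith

/-- Griffith's criterion, expressed with the incoming derivative `a`, selects the speed of the
front. -/
lemma eq_griffithSpeed {a k v yt yx : ℝ} (hk : 0 < k) (hv : 0 ≤ v) (hfront : yt + v * yx = 0)
    (ha : a = (yt - yx) / 2) (hle : 1 / 2 * (1 - v ^ 2) * yx ^ 2 ≤ k)
    (heq : v * (1 / 2 * (1 - v ^ 2) * yx ^ 2 - k) = 0) : v = griffithSpeed a k := by
  have ha' : 2 * a ^ 2 = (1 + v) ^ 2 * yx ^ 2 / 2 := by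
    rw [ha, show yt = -(v * yx) by linarith]; ring
  have hpos : 0 < 2 * a ^ 2 + k := by positivity
  rcases hv.eq_or_lt with rfl | hv
  · rw [griffithSpeed, max_eq_right]
    exact div_nonpos_of_nonpos_of_nonneg (by rw [ha']; nlinarith) hpos.le
  · have hk' : 1 / 2 * (1 - v ^ 2) * yx ^ 2 = k := by
      rcases mul_eq_zero.1 heq with h | h <;> linarith
    have h1 : v = (2 * a ^ 2 - k) / (2 * a ^ 2 + k) := by
      rw [eq_div_iff hpos.ne', ha', ← hk']; ring
    rw [griffithSpeed, ← h1, max_eq_left hv.le]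

namespace IsC1Solution

variable {κ : ℝ → ℝ} {T ℓ₀ : ℝ} {y₀ y₁ u ℓ : ℝ → ℝ} {y : ℝ × ℝ → ℝ}

section

variable (h : IsC1Solution κ T ℓ₀ y₀ y₁ u ℓ y) (hT : 0 < T)
include h

lemma hasDerivWithinAt {t : ℝ} (ht : t ∈ Icc 0 T) :
    HasDerivWithinAt ℓ (derivWithin ℓ (Icc 0 T) t) (Icc 0 T) t :=
  (h.front_regular.differentiableOn (by simp) t ht).hasDerivWithinAt

lemma monotoneOn : MonotoneOn ℓ (Icc 0 T) := by
  refine monotoneOn_of_deriv_nonneg (convex_Icc 0 T) h.front_regular.continuousOn ?_ ?_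
  · exact (h.front_regular.differentiableOn (by simp)).mono interior_subset
  · intro t ht
    rw [interior_Icc] at ht
    rw [← derivWithin_of_mem_nhds (Icc_mem_nhds ht.1 ht.2)]
    exact h.front_mono t (Ioo_subset_Ioc_self ht)

include hT

lemma le_front {t : ℝ} (ht : t ∈ Icc 0 T) : ℓ₀ ≤ ℓ t := by
  rw [← h.front_initial]
  exact h.monotoneOn (left_mem_Icc.2 hT.le) ht ht.1

variable (hℓ₀ : 0 < ℓ₀)
include hℓ₀

lemma uniqueDiffOn : UniqueDiffOn ℝ (closedRegion T ℓ) :=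
  uniqueDiffOn_closedRegion hT h.front_regular (h.monotoneOn) (by rw [h.front_initial]; exact hℓ₀)

lemma front_mem {t : ℝ} (ht : t ∈ Icc 0 T) : (t, ℓ t) ∈ closedRegion T ℓ :=
  ⟨ht.1, ht.2, hℓ₀.le.trans (h.le_front hT ht), le_rfl⟩

lemma axis_mem {t : ℝ} (ht : t ∈ Icc 0 T) : (t, 0) ∈ closedRegion T ℓ :=
  ⟨ht.1, ht.2, le_rfl, hℓ₀.le.trans (h.le_front hT ht)⟩

omit hT hℓ₀ in
lemma initial_mem (hT : 0 ≤ T) {x : ℝ} (hx : x ∈ Icc 0 ℓ₀) : (0, x) ∈ closedRegion T ℓ :=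
  ⟨le_rfl, hT, hx.1, by simpa [h.front_initial] using hx.2⟩

omit hT hℓ₀ in
/-- The chain rule along a curve in the closed region. -/
lemma hasDerivWithinAt_comp {γ : ℝ → ℝ × ℝ} {s : Set ℝ} {r a b : ℝ}
    (hmaps : MapsTo γ s (closedRegion T ℓ)) (hr : r ∈ s) (hγ : HasDerivWithinAt γ (a, b) s r) :
    HasDerivWithinAt (fun r => y (γ r)) (a * dt T ℓ y (γ r) + b * dx T ℓ y (γ r)) s r := by
  have h1 := ((h.disp_regular.differentiableOn (by simp)) _ (hmaps hr)).hasFDerivWithinAt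
  have h2 := h1.comp_hasDerivWithinAt r hγ hmaps
  have h3 : ((a, b) : ℝ × ℝ) = a • (1, 0) + b • (0, 1) := by simp
  rw [h3, map_add, map_smul, map_smul] at h2
  exact h2

/-- The derivative of the boundary condition at the front. -/
lemma front_relation {t : ℝ} (ht : t ∈ Icc 0 T) :
    dt T ℓ y (t, ℓ t) + derivWithin ℓ (Icc 0 T) t * dx T ℓ y (t, ℓ t) = 0 := by
  have h1 := h.hasDerivWithinAt_comp (γ := fun t => (t, ℓ t)) (s := Icc 0 T)
    (fun s hs => h.front_mem hT hℓ₀ hs) ht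
    ((hasDerivWithinAt_id t _).prodMk (h.hasDerivWithinAt ht))
  have h2 : HasDerivWithinAt (fun t => y (t, ℓ t)) 0 (Icc 0 T) t :=
    (hasDerivWithinAt_const t _ (0 : ℝ)).congr (fun s hs => h.front_boundary s hs)
      (h.front_boundary t ht)
  have := (uniqueDiffOn_Icc hT t ht).eq_deriv _ h1 h2
  simpa using this

lemma dt_axis {t : ℝ} (ht : t ∈ Icc 0 T) : dt T ℓ y (t, 0) = derivWithin u (Icc 0 T) t := by
  have h1 := h.hasDerivWithinAt_comp (γ := fun t => (t, 0)) (s := Icc 0 T)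
    (fun s hs => h.axis_mem hT hℓ₀ hs) ht
    ((hasDerivWithinAt_id t _).prodMk (hasDerivWithinAt_const t _ (0 : ℝ)))
  have h2 := h1.congr (fun s hs => (h.left_boundary s hs).symm) (h.left_boundary t ht).symm
  rw [h2.derivWithin (uniqueDiffOn_Icc hT t ht)]
  simp

lemma dx_initial {x : ℝ} (hx : x ∈ Icc 0 ℓ₀) : dx T ℓ y (0, x) = derivWithin y₀ (Icc 0 ℓ₀) x := by
  have h1 := h.hasDerivWithinAt_comp (γ := fun x => (0, x)) (s := Icc 0 ℓ₀)
    (fun s hs => h.initial_mem hT.le hs) hx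
    ((hasDerivWithinAt_const x _ (0 : ℝ)).prodMk (hasDerivWithinAt_id x _))
  have h2 := h1.congr (fun s hs => (h.initial_disp s hs).symm) (h.initial_disp x hx).symm
  rw [h2.derivWithin (uniqueDiffOn_Icc hℓ₀ x hx)]
  simp

variable (hκ : ∀ x ∈ Ici (0 : ℝ), 0 < κ x)
include hκ

/-- Eliminates the reflected wave: the speed now depends only on the incoming derivative and the
position. -/
lemma speed_eq {t : ℝ} (ht : t ∈ Ioc 0 T) : derivWithin ℓ (Icc 0 T) t =
    griffithSpeed ((dt T ℓ y (t, ℓ t) - dx T ℓ y (t, ℓ t)) / 2) (κ (ℓ t)) := by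
  have ht' := Ioc_subset_Icc_self ht
  exact eq_griffithSpeed (hκ _ (hℓ₀.le.trans (h.le_front hT ht'))) (h.front_mono t ht)
    (h.front_relation hT hℓ₀ ht') rfl (h.griffith_le t ht) (h.griffith_eq t ht)

/-- The front is slower than the waves. Hence t - ℓ(t) is a legitimate coordinate on the front, and
a right-going characteristic traced backwards stays below the front. -/
lemma strictMonoOn_sub : StrictMonoOn (fun t => t - ℓ t) (Icc 0 T) := by
  refine strictMonoOn_of_deriv_pos (convex_Icc 0 T)
    (continuousOn_id.sub h.front_regular.continuousOn) fun t ht => ?_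
  rw [interior_Icc] at ht
  have h1 := (h.hasDerivWithinAt (Ioo_subset_Icc_self ht)).hasDerivAt (Icc_mem_nhds ht.1 ht.2)
  rw [((hasDerivAt_id' t).fun_sub h1).deriv, h.speed_eq hT hℓ₀ hκ (Ioo_subset_Ioc_self ht), sub_pos]
  exact griffithSpeed_lt_one _
    (hκ _ (hℓ₀.le.trans (h.le_front hT (Ioo_subset_Icc_self ht))))

/-- `∂ₜ y - ∂ₓ y` is transported to the right, from the initial data. -/
lemma incoming_initial {t x : ℝ} (hp : (t, x) ∈ closedRegion T ℓ) (hs : t ≤ x) :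
    x - t ∈ Icc 0 ℓ₀ ∧ dt T ℓ y (t, x) - dx T ℓ y (t, x) =
      dt T ℓ y (0, x - t) - dx T ℓ y (0, x - t) := by
  obtain ⟨ht0, htT, hx0, hxℓ⟩ := hp
  simp only at ht0 htT hx0 hxℓ
  have hmono := h.strictMonoOn_sub hT hℓ₀ hκ
  have hle : ∀ s ∈ Icc 0 t, x - t ≤ ℓ s - s := fun s hs' => by
    have := hmono.monotoneOn ⟨hs'.1, hs'.2.trans htT⟩ ⟨ht0, htT⟩ hs'.2
    linarith
  have h0 : x - t ∈ Icc 0 ℓ₀ := ⟨by linarith, by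
    simpa [h.front_initial] using hle 0 ⟨le_rfl, ht0⟩⟩
  refine ⟨h0, ?_⟩
  have := const_along_characteristic h.front_regular.continuousOn (h.uniqueDiffOn hT hℓ₀)
    h.disp_regular h.wave (e := 1) (by norm_num) (ξ := x - t) ht0
    (by simpa using h.initial_mem hT.le h0) (by simpa using ⟨ht0, htT, hx0, hxℓ⟩) fun s hs' => ?_
  · simpa using this.symm
  · refine ⟨hs'.1, hs'.2.trans_le htT, by simp only; linarith [hs'.1], ?_⟩
    have := hmono ⟨hs'.1.le, hs'.2.le.trans htT⟩ ⟨ht0, htT⟩ hs'.2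
    simp only at this ⊢
    linarith

/-- `∂ₜ y - ∂ₓ y` is transported to the right, from the boundary `x = 0`. -/
lemma incoming_axis {t x : ℝ} (hp : (t, x) ∈ closedRegion T ℓ) (hs : x ≤ t) :
    dt T ℓ y (t, x) - dx T ℓ y (t, x) = dt T ℓ y (t - x, 0) - dx T ℓ y (t - x, 0) := by
  obtain ⟨ht0, htT, hx0, hxℓ⟩ := hp
  simp only at ht0 htT hx0 hxℓ
  have hmono := h.strictMonoOn_sub hT hℓ₀ hκ
  have := const_along_characteristic h.front_regular.continuousOn (h.uniqueDiffOn hT hℓ₀)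
    h.disp_regular h.wave (e := 1) (by norm_num) (ξ := x - t) (t₀ := t - x) (t₁ := t) (by linarith)
    (by simpa using h.axis_mem hT hℓ₀ (t := t - x) ⟨by linarith, by linarith⟩)
    (by simpa using ⟨ht0, htT, hx0, hxℓ⟩) fun s hs' => ?_
  · simpa using this.symm
  · have hs0 : 0 < s := by linarith [hs'.1]
    refine ⟨hs0, hs'.2.trans_le htT, by simp only; linarith [hs'.1], ?_⟩
    have := hmono ⟨hs0.le, hs'.2.le.trans htT⟩ ⟨ht0, htT⟩ hs'.2
    simp only at this ⊢
    linarith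

omit hκ in
/-- `∂ₜ y + ∂ₓ y` is transported to the left, from the initial data. -/
lemma outgoing_initial {t x : ℝ} (hp : (t, x) ∈ closedRegion T ℓ) (hz : t + x ≤ ℓ₀) :
    dt T ℓ y (t, x) + dx T ℓ y (t, x) = dt T ℓ y (0, t + x) + dx T ℓ y (0, t + x) := by
  obtain ⟨ht0, htT, hx0, hxℓ⟩ := hp
  simp only at ht0 htT hx0 hxℓ
  have := const_along_characteristic h.front_regular.continuousOn (h.uniqueDiffOn hT hℓ₀)
    h.disp_regular h.wave (e := -1) (by norm_num) (ξ := t + x) ht0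
    (by simpa using h.initial_mem hT.le (x := t + x) ⟨by linarith, hz⟩)
    (by simpa using ⟨ht0, htT, hx0, hxℓ⟩) fun s hs' => ?_
  · simpa using this.symm
  · refine ⟨hs'.1, hs'.2.trans_le htT, by simp only; linarith [hs'.2], ?_⟩
    have := h.le_front hT (t := s) ⟨hs'.1.le, hs'.2.le.trans htT⟩
    simp only
    linarith [hs'.1]

omit hκ in
/-- `∂ₜ y + ∂ₓ y` is transported to the left, from the front. -/
lemma outgoing_front {t x t' : ℝ} (hp : (t, x) ∈ closedRegion T ℓ) (ht' : t' ∈ Icc 0 T)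
    (hz : t' + ℓ t' = t + x) :
    dt T ℓ y (t, x) + dx T ℓ y (t, x) = dt T ℓ y (t', ℓ t') + dx T ℓ y (t', ℓ t') := by
  obtain ⟨ht0, htT, hx0, hxℓ⟩ := hp
  simp only at ht0 htT hx0 hxℓ
  have hmono := h.monotoneOn
  -- The point (t, x) lies below the front, so a nondecreasing front can only have met this
  -- left-going characteristic earlier.
  have hle : t' ≤ t := by
    by_contra! hlt
    linarith [hmono ⟨ht0, htT⟩ ht' hlt.le]
  have := const_along_characteristic h.front_regular.continuousOn (h.uniqueDiffOn hT hℓ₀)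
    h.disp_regular h.wave (e := -1) (by norm_num) (ξ := t + x) hle
    (by simpa [← hz] using h.front_mem hT hℓ₀ ht')
    (by simpa using ⟨ht0, htT, hx0, hxℓ⟩) fun s hs' => ?_
  · have h2 : t + x + -1 * t' = ℓ t' := by linarith
    have h3 : t + x + -1 * t = x := by ring
    rw [h2, h3] at this
    linarith
  · refine ⟨ht'.1.trans_lt hs'.1, hs'.2.trans_le htT, by simp only; linarith [hs'.2], ?_⟩
    have := hmono ht' ⟨ht'.1.trans hs'.1.le, hs'.2.le.trans htT⟩ hs'.1.le
    simp only
    linarith [hs'.1]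

omit hT hℓ₀ hκ in
/-- The displacement is determined by its `x` derivative. -/
lemma hasDerivWithinAt_vertical {t x : ℝ} (ht : t ∈ Icc 0 T) (hx : x ∈ Icc 0 (ℓ t)) :
    HasDerivWithinAt (fun x => y (t, x)) (dx T ℓ y (t, x)) (Icc 0 (ℓ t)) x := by
  have h1 := h.hasDerivWithinAt_comp (γ := fun x => (t, x)) (s := Icc 0 (ℓ t))
    (fun z hz => ⟨ht.1, ht.2, hz.1, hz.2⟩) hx
    ((hasDerivWithinAt_const x _ t).prodMk (hasDerivWithinAt_id x _))
  simpa using h1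

end

end IsC1Solution

/-! ### The front in the emission coordinate `s = t - ℓ(t)` -/

/-- The slope `dℓ/ds` of the front in the coordinate `s = t - ℓ(t)`. -/
noncomputable def emissionSlope (a k : ℝ) : ℝ := max (a ^ 2 / k - 1 / 2) 0

/-- Change of variable t = s + L(s): dℓ/dt = (dL/ds) / (1 + dL/ds). -/
lemma griffithSpeed_eq_emissionSlope_div (a : ℝ) {k : ℝ} (hk : 0 < k) :
    griffithSpeed a k = emissionSlope a k / (1 + emissionSlope a k) := by
  rw [griffithSpeed, emissionSlope]
  have hpos : 0 < 2 * a ^ 2 + k := by positivity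
  rcases le_total k (2 * a ^ 2) with h | h
  · have h1 : 0 ≤ a ^ 2 / k - 1 / 2 := by
      rw [sub_nonneg, le_div_iff₀ hk]; linarith
    have h2 : 0 < 1 + (a ^ 2 / k - 1 / 2) := by linarith
    rw [max_eq_left h1, max_eq_left (div_nonneg (by linarith) hpos.le),
      div_eq_div_iff hpos.ne' h2.ne']
    field_simp
    ring
  · have h1 : a ^ 2 / k - 1 / 2 ≤ 0 := by
      rw [sub_nonpos, div_le_iff₀ hk]; linarith
    rw [max_eq_right h1, max_eq_right (div_nonpos_of_nonpos_of_nonneg (by linarith) hpos.le)]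
    simp

lemma emissionSlope_nonneg (a k : ℝ) : 0 ≤ emissionSlope a k := le_max_right _ _

/-- The Lipschitz bound in the toughness on which both Picard–Lindelöf and the Grönwall argument for
the front rest; k ↦ 1/k is Lipschitz away from 0. -/
lemma abs_emissionSlope_sub_le {a B k k' c : ℝ} (hc : 0 < c) (ha : |a| ≤ B) (hk : c ≤ k)
    (hk' : c ≤ k') :
    |emissionSlope a k - emissionSlope a k'| ≤ B ^ 2 / c ^ 2 * |k - k'| := by
  have hk0 := hc.trans_le hk
  have hk0' := hc.trans_le hk'
  refine (abs_max_sub_max_le_abs _ _ _).trans ?_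
  have h1 : a ^ 2 / k - 1 / 2 - (a ^ 2 / k' - 1 / 2) = a ^ 2 / (k * k') * (k' - k) := by
    field_simp; ring
  rw [h1, abs_mul, abs_sub_comm k' k, abs_of_nonneg (by positivity)]
  refine mul_le_mul_of_nonneg_right ?_ (abs_nonneg _)
  have h2 : a ^ 2 ≤ B ^ 2 := sq_le_sq' (neg_le_of_abs_le ha) (le_of_abs_le ha)
  refine div_le_div₀ (sq_nonneg B) h2 (by positivity) ?_
  rw [sq]
  exact mul_le_mul hk hk' hc.le hk0.le

/-- `L` is a front, parametrized by the emission coordinate, that starts at `L (-ℓ₀) = ℓ₀` and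
obeys Griffith's criterion for the incoming derivative `F` on `[-ℓ₀, S]`. -/
structure FrontProfile (κ : ℝ → ℝ) (ℓ₀ S : ℝ) (L P F : ℝ → ℝ) : Prop where
  continuous_slope : Continuous P
  continuous_incoming : Continuous F
  hasDerivAt : ∀ s, HasDerivAt L (P s) s
  slope_nonneg : ∀ s, 0 ≤ P s
  initial : L (-ℓ₀) = ℓ₀
  evolution : ∀ s ∈ Icc (-ℓ₀) S, P s = emissionSlope (F s) (κ (L s))

/-- Slope at least 1 forces both infinite limits, hence surjectivity. It serves s + L(s), the time
of arrival at the front, and s + 2L(s), the phase of the reflected wave. -/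
lemma exists_inverse_of_one_le_deriv {φ φ' : ℝ → ℝ} (h : ∀ s, HasDerivAt φ (φ' s) s)
    (h1 : ∀ s, 1 ≤ φ' s) :
    ∃ ψ : ℝ → ℝ, (∀ x, φ (ψ x) = x) ∧ (∀ s, ψ (φ s) = s) ∧ StrictMono ψ ∧
      ∀ x, HasDerivAt ψ (φ' (ψ x))⁻¹ x := by
  have hmono : StrictMono φ := strictMono_of_deriv_pos fun s => by
    rw [(h s).deriv]; linarith [h1 s]
  have hcont : Continuous φ := continuous_iff_continuousAt.2 fun s => (h s).continuousAt
  have hexp : ∀ s t, s ≤ t → t - s ≤ φ t - φ s := by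
    intro s t hst
    have hm : MonotoneOn (fun r => φ r - r) univ := monotoneOn_of_deriv_nonneg convex_univ
      (hcont.sub continuous_id).continuousOn
      (fun r _ => ((h r).sub (hasDerivAt_id r)).differentiableAt.differentiableWithinAt)
      fun r _ => by rw [((h r).fun_sub (hasDerivAt_id' r)).deriv]; linarith [h1 r]
    have := hm (mem_univ s) (mem_univ t) hst
    simp only at this
    linarith
  have hsurj : Function.Surjective φ := by
    refine hcont.surjective ?_ ?_
    · refine tendsto_atTop_mono' atTop ?_ (tendsto_atTop_add_const_right atTop (φ 0) tendsto_id)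
      filter_upwards [eventually_ge_atTop 0] with s hs
      have := hexp 0 s hs
      simp only [id]; linarith
    · refine tendsto_atBot_mono' atBot ?_ (tendsto_atBot_add_const_right atBot (φ 0) tendsto_id)
      filter_upwards [eventually_le_atBot 0] with s hs
      have := hexp s 0 hs
      simp only [id]; linarith
  let e := hmono.orderIsoOfSurjective φ hsurj
  have he : ∀ x, φ (e.symm x) = x := fun x => e.apply_symm_apply x
  exact ⟨e.symm, he, fun s => e.symm_apply_apply s, e.symm.strictMono, fun x =>
    (h (e.symm x)).of_local_left_inverse e.symm.continuous.continuousAt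
      (by linarith [h1 (e.symm x)]) (Eventually.of_forall he)⟩

namespace FrontProfile

variable {κ : ℝ → ℝ} {ℓ₀ S : ℝ} {L P F : ℝ → ℝ}

lemma monotone (W : FrontProfile κ ℓ₀ S L P F) : Monotone L :=
  monotone_of_deriv_nonneg (fun s => (W.hasDerivAt s).differentiableAt) fun s => by
    rw [(W.hasDerivAt s).deriv]; exact W.slope_nonneg s

lemma le_front (W : FrontProfile κ ℓ₀ S L P F) {s : ℝ} (hs : -ℓ₀ ≤ s) : ℓ₀ ≤ L s := by
  have := W.monotone hs
  rwa [W.initial] at this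

lemma monotoneOn_of_griffithSpeed (hκ : ∀ x ∈ Ici (0 : ℝ), 0 < κ x) {c : ℝ} (hc : 0 ≤ c)
    {m a : ℝ → ℝ} (hm0 : 0 ≤ m 0)
    (hm : ∀ t ∈ Icc 0 c, HasDerivWithinAt m (griffithSpeed (a t) (κ (m t))) (Icc 0 c) t) :
    MonotoneOn m (Icc 0 c) ∧ MonotoneOn (fun t => t - m t) (Icc 0 c) := by
  have hmc : ContinuousOn m (Icc 0 c) := fun t ht => (hm t ht).continuousWithinAt
  have hmd : ∀ t ∈ interior (Icc 0 c), HasDerivAt m (griffithSpeed (a t) (κ (m t))) t :=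
    fun t ht => by
      rw [interior_Icc] at ht
      exact (hm t (Ioo_subset_Icc_self ht)).hasDerivAt (Icc_mem_nhds ht.1 ht.2)
  have hmono : MonotoneOn m (Icc 0 c) := by
    refine monotoneOn_of_deriv_nonneg (convex_Icc 0 c) hmc
      (fun t ht => (hmd t ht).differentiableAt.differentiableWithinAt) fun t ht => ?_
    rw [(hmd t ht).deriv]
    exact griffithSpeed_nonneg _ _
  refine ⟨hmono, monotoneOn_of_deriv_nonneg (convex_Icc 0 c) (continuousOn_id.sub hmc)
    (fun t ht => ((hasDerivAt_id t).sub (hmd t ht)).differentiableAt.differentiableWithinAt)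
    fun t ht => ?_⟩
  rw [((hasDerivAt_id' t).fun_sub (hmd t ht)).deriv, sub_nonneg]
  have ht' := interior_subset ht
  exact (griffithSpeed_lt_one _
    (hκ _ (hm0.trans (hmono (left_mem_Icc.2 hc) ht' ht'.1)))).le

/-- A front that obeys Griffith's criterion in the time variable, with the incoming derivative of
the profile, coincides with the profile. -/
lemma eq_of_griffithSpeed (W : FrontProfile κ ℓ₀ S L P F) (hℓ₀ : 0 < ℓ₀) {c₁ : ℝ} (hc₁ : 0 < c₁)
    (hκ : ∀ x ∈ Ici (0 : ℝ), c₁ ≤ κ x) (hκ_lip : LocallyLipschitzOn (Ici (0 : ℝ)) κ)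
    {c : ℝ} (hc : 0 ≤ c) {m : ℝ → ℝ} (hm0 : m 0 = ℓ₀)
    (hm : ∀ t ∈ Icc 0 c,
      HasDerivWithinAt m (griffithSpeed (F (t - m t)) (κ (m t))) (Icc 0 c) t)
    (hcS : c - m c ≤ S) {t : ℝ} (ht : t ∈ Icc 0 c) : m t = L (t - m t) := by
  obtain ⟨hmono, hmono'⟩ := monotoneOn_of_griffithSpeed (a := fun t => F (t - m t))
    (fun x hx => hc₁.trans_le (hκ x hx)) hc (hm0.symm ▸ hℓ₀.le) hm
  have hml : ∀ t ∈ Icc 0 c, ℓ₀ ≤ m t := fun t ht => by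
    rw [← hm0]; exact hmono (left_mem_Icc.2 hc) ht ht.1
  have hκm : ∀ t ∈ Icc 0 c, 0 < κ (m t) := fun t ht =>
    hc₁.trans_le (hκ _ (hℓ₀.le.trans (hml t ht)))
  have hs : ∀ t ∈ Icc 0 c, t - m t ∈ Icc (-ℓ₀) S := fun t ht => by
    have h1 := hmono' (left_mem_Icc.2 hc) ht ht.1
    have h2 := hmono' ht (right_mem_Icc.2 hc) ht.2
    simp only [hm0] at h1 h2
    exact ⟨by linarith, by linarith⟩
  obtain ⟨B, hB⟩ := isCompact_Icc.exists_bound_of_continuousOn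
    (W.continuous_incoming.continuousOn (s := Icc (-ℓ₀) S))
  obtain ⟨K, hK⟩ := (hκ_lip.mono
    (show Icc 0 (max (m c) (L S)) ⊆ Ici (0 : ℝ) from fun _ hx => hx.1))
      |>.exists_lipschitzOnWith_of_compact isCompact_Icc
  set E : ℝ → ℝ → ℝ := fun s l => emissionSlope (F s) (κ l) with hE
  -- With E the emission slope at m(t), m' = E/(1 + E) = (1 - m')E, while L(t - m) has derivative (1
  -- - m') times the slope of the profile.
  have hD : ∀ t ∈ Icc 0 c, HasDerivWithinAt (fun t => m t - L (t - m t))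
      ((1 - griffithSpeed (F (t - m t)) (κ (m t))) *
        (E (t - m t) (m t) - E (t - m t) (L (t - m t)))) (Icc 0 c) t := by
    intro t ht
    have h1 := (hm t ht).sub ((W.hasDerivAt (t - m t)).comp_hasDerivWithinAt t
      ((hasDerivWithinAt_id t _).sub (hm t ht)))
    refine h1.congr_deriv ?_
    rw [W.evolution _ (hs t ht)]
    have h2 := emissionSlope_nonneg (F (t - m t)) (κ (m t))
    rw [griffithSpeed_eq_emissionSlope_div _ (hκm t ht)]
    simp only [hE]
    field_simp
    ring
  -- Grönwall: 0 < 1 - m' ≤ 1, and the emission slope is Lipschitz in the position because κ is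
  -- Lipschitz on the compact range of both fronts.
  have hzero := eq_zero_of_abs_deriv_le_mul_abs_self_of_eq_zero_right
    (f := fun t => m t - L (t - m t)) (K := B ^ 2 / c₁ ^ 2 * K)
    (fun t ht => (hD t ht).continuousWithinAt)
    (fun t ht => (hD t (Ico_subset_Icc_self ht)).mono_of_mem_nhdsWithin (Icc_mem_nhdsGE_of_mem ht))
    (by simp [hm0, W.initial]) (fun t ht => ?_) t ht
  · exact sub_eq_zero.1 hzero
  · have ht := Ico_subset_Icc_self ht
    have hLs := W.le_front (hs t ht).1
    have g1 : m t ∈ Icc 0 (max (m c) (L S)) :=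
      ⟨hℓ₀.le.trans (hml t ht), (hmono ht (right_mem_Icc.2 hc) ht.2).trans (le_max_left _ _)⟩
    have g2 : L (t - m t) ∈ Icc 0 (max (m c) (L S)) :=
      ⟨hℓ₀.le.trans hLs, (W.monotone (hs t ht).2).trans (le_max_right _ _)⟩
    have e1 := abs_emissionSlope_sub_le hc₁ (hB _ (hs t ht)) (hκ _ g1.1) (hκ _ g2.1)
    have e2 := hK.dist_le_mul _ g1 _ g2
    rw [Real.dist_eq, Real.dist_eq] at e2
    have v0 := griffithSpeed_nonneg (F (t - m t)) (κ (m t))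
    have v1 := griffithSpeed_lt_one (F (t - m t)) (hκm t ht)
    rw [norm_mul, Real.norm_eq_abs, Real.norm_eq_abs, abs_of_nonneg (by linarith), Real.norm_eq_abs]
    calc _ ≤ 1 * (B ^ 2 / c₁ ^ 2 * (K * |m t - L (t - m t)|)) := by
          refine mul_le_mul (by linarith) (e1.trans ?_) (abs_nonneg _) zero_le_one
          exact mul_le_mul_of_nonneg_left e2 (by positivity)
      _ = _ := by ring

end FrontProfile

/-! ### The solution generated by a front profile -/

/-- A front profile together with the outgoing derivative `H` that is reflected by the front, and
the emission coordinate `σ` as a function of time. -/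
structure WaveProfile (κ : ℝ → ℝ) (ℓ₀ S : ℝ) (L P F H σ : ℝ → ℝ) : Prop extends
    FrontProfile κ ℓ₀ S L P F where
  continuous_outgoing : Continuous H
  reflection : ∀ s, -ℓ₀ ≤ s → H (s + 2 * L s) * (1 + 2 * P s) = -F s
  emission_left_inv : ∀ s, σ (s + L s) = s
  emission_right_inv : ∀ t, σ t + L (σ t) = t
  hasDerivAt_emission : ∀ t, HasDerivAt σ (1 + P (σ t))⁻¹ t

/-- The displacement with incoming derivative `F` and outgoing derivative `H` that vanishes at the
initial position of the front. -/
noncomputable def displacement (ℓ₀ : ℝ) (F H : ℝ → ℝ) (p : ℝ × ℝ) : ℝ :=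
  (∫ s in (-ℓ₀)..(p.1 - p.2), F s) + ∫ z in ℓ₀..(p.1 + p.2), H z

section Displacement

variable {ℓ₀ : ℝ} {F H : ℝ → ℝ}

lemma hasDerivAt_integral_of_continuous (hF : Continuous F) (a s : ℝ) :
    HasDerivAt (fun s => ∫ r in a..s, F r) (F s) s :=
  intervalIntegral.integral_hasDerivAt_right (hF.intervalIntegrable _ _)
    (hF.stronglyMeasurableAtFilter _ _) hF.continuousAt

lemma hasFDerivAt_displacement (hF : Continuous F) (hH : Continuous H) (p : ℝ × ℝ) :
    HasFDerivAt (displacement ℓ₀ F H)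
      (F (p.1 - p.2) • (ContinuousLinearMap.fst ℝ ℝ ℝ - ContinuousLinearMap.snd ℝ ℝ ℝ) +
        H (p.1 + p.2) • (ContinuousLinearMap.fst ℝ ℝ ℝ + ContinuousLinearMap.snd ℝ ℝ ℝ)) p := by
  have h1 : HasFDerivAt (fun p : ℝ × ℝ => p.1 - p.2)
    (ContinuousLinearMap.fst ℝ ℝ ℝ - ContinuousLinearMap.snd ℝ ℝ ℝ) p :=
    hasFDerivAt_fst.sub hasFDerivAt_snd
  have h2 : HasFDerivAt (fun p : ℝ × ℝ => p.1 + p.2)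
    (ContinuousLinearMap.fst ℝ ℝ ℝ + ContinuousLinearMap.snd ℝ ℝ ℝ) p :=
    hasFDerivAt_fst.add hasFDerivAt_snd
  exact ((hasDerivAt_integral_of_continuous hF (-ℓ₀) (p.1 - p.2)).comp_hasFDerivAt p h1).add
    ((hasDerivAt_integral_of_continuous hH ℓ₀ (p.1 + p.2)).comp_hasFDerivAt p h2)

lemma contDiff_displacement (hF : Continuous F) (hH : Continuous H) :
    ContDiff ℝ 1 (displacement ℓ₀ F H) := by
  rw [contDiff_one_iff_fderiv]
  refine ⟨fun p => (hasFDerivAt_displacement hF hH p).differentiableAt, ?_⟩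
  rw [show fderiv ℝ (displacement ℓ₀ F H) = _ from
    funext fun p => (hasFDerivAt_displacement hF hH p).fderiv]
  fun_prop

variable {T : ℝ} {ℓ : ℝ → ℝ}

lemma fderivWithin_displacement (hF : Continuous F) (hH : Continuous H)
    (hu : UniqueDiffOn ℝ (closedRegion T ℓ)) {p : ℝ × ℝ} (hp : p ∈ closedRegion T ℓ) :
    dt T ℓ (displacement ℓ₀ F H) p = F (p.1 - p.2) + H (p.1 + p.2) ∧
      dx T ℓ (displacement ℓ₀ F H) p = -F (p.1 - p.2) + H (p.1 + p.2) := by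
  have h := (hasFDerivAt_displacement (ℓ₀ := ℓ₀) hF hH p).hasFDerivWithinAt.fderivWithin (hu p hp)
  simp [dt, dx, h]

/-- Integration by parts moves the derivative to w, which does not change in the direction v. No
differentiability of w is needed. -/
lemma integral_mul_fderiv_eq_zero {w : ℝ × ℝ → ℝ} (hw : Continuous w) {v : ℝ × ℝ}
    (hconst : ∀ q (s : ℝ), w (q + s • v) = w q) {φ : ℝ × ℝ → ℝ} (hφ : ContDiff ℝ ∞ φ)
    (hc : HasCompactSupport φ) : ∫ q, w q * fderiv ℝ φ q v = 0 := by
  have hφ' : Continuous (fderiv ℝ φ) := hφ.continuous_fderiv (by simp)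
  have h := integral_bilinear_hasLineDerivAt_right_eq_neg_left_of_integrable
    (μ := (volume : Measure (ℝ × ℝ))) (v := v)
    (B := ContinuousLinearMap.mul ℝ ℝ) (f := w) (f' := fun _ => 0) (g := φ)
    (g' := fun q => fderiv ℝ φ q v) (by simp) ?_ ?_ ?_ ?_
  · simpa using h
  · exact integrable_mul_of_tsupport_subset isOpen_univ hw.continuousOn
      (hφ'.clm_apply continuous_const) (hc.fderiv_apply ℝ v) (subset_univ _)
  · exact integrable_mul_of_tsupport_subset isOpen_univ hw.continuousOn hφ.continuous hc
      (subset_univ _)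
  · intro q _
    simpa [HasLineDerivAt, hconst] using hasDerivAt_const (0 : ℝ) (w q)
  · exact fun q _ => ((hφ.differentiable (by simp) q).hasFDerivAt).hasLineDerivAt v

/-- The integrand regroups as F(t - x) times the (1, 1)-derivative of φ plus H(t + x) times its (1,
-1)-derivative. -/
lemma isWeakWave_displacement (hF : Continuous F) (hH : Continuous H)
    (hℓ : ContinuousOn ℓ (Icc 0 T)) (hu : UniqueDiffOn ℝ (closedRegion T ℓ)) :
    IsWeakWave T ℓ (displacement ℓ₀ F H) := by
  intro φ hφ hc hs
  have hO := isOpen_openRegion hℓ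
  have hφ' : Continuous (fderiv ℝ φ) := hφ.continuous_fderiv (by simp)
  have h1 := integral_mul_fderiv_eq_zero (w := fun q => F (q.1 - q.2)) (v := (1, 1))
    (by fun_prop) (fun q s => by simp) hφ hc
  have h2 := integral_mul_fderiv_eq_zero (w := fun q => H (q.1 + q.2)) (v := (1, -1))
    (by fun_prop) (fun q s => by
      simp only [Prod.fst_add, Prod.snd_add, Prod.smul_fst, Prod.smul_snd, smul_eq_mul]
      congr 1; ring) hφ hc
  have hi : ∀ {G : ℝ × ℝ → ℝ} (_ : Continuous G) (v : ℝ × ℝ),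
      Integrable fun q => G q * fderiv ℝ φ q v := fun hG v =>
    integrable_mul_of_tsupport_subset isOpen_univ hG.continuousOn
      (hφ'.clm_apply continuous_const) (hc.fderiv_apply ℝ v) (subset_univ _)
  have h3 : ∫ q : ℝ × ℝ, (F (q.1 - q.2) * fderiv ℝ φ q (1, 1) +
      H (q.1 + q.2) * fderiv ℝ φ q (1, -1)) = 0 := by
    rw [integral_add (hi (by fun_prop) _) (hi (by fun_prop) _), h1, h2, add_zero]
  refine Eq.trans ?_ h3
  rw [← integral_indicator hO.measurableSet]
  refine integral_congr_ae (Eventually.of_forall fun q => ?_)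
  by_cases hq : q ∈ openRegion T ℓ
  · obtain ⟨e1, e2⟩ := fderivWithin_displacement (ℓ₀ := ℓ₀) hF hH hu
      (openRegion_subset_closedRegion hq)
    have s1 : fderiv ℝ φ q (1, 1) = fderiv ℝ φ q (1, 0) + fderiv ℝ φ q (0, 1) := by
      rw [← map_add]; simp
    have s2 : fderiv ℝ φ q (1, -1) = fderiv ℝ φ q (1, 0) - fderiv ℝ φ q (0, 1) := by
      rw [← map_sub]; simp
    simp only [indicator_of_mem hq, e1, e2, s1, s2]
    ring
  · have : fderiv ℝ φ q = 0 := by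
      by_contra h
      exact hq (hs (support_fderiv_subset ℝ h))
    simp [hq, this]

end Displacement

/-- Griffith's criterion, in the emission coordinate. -/
lemma griffith_of_emissionSlope {F H P k : ℝ} (hk : 0 < k) (hP : P = emissionSlope F k)
    (hH : H * (1 + 2 * P) = -F) :
    1 / 2 * (1 - (P / (1 + P)) ^ 2) * (-F + H) ^ 2 ≤ k ∧
      P / (1 + P) * (1 / 2 * (1 - (P / (1 + P)) ^ 2) * (-F + H) ^ 2 - k) = 0 := by
  have hP0 : 0 ≤ P := hP ▸ emissionSlope_nonneg F k
  have h1 : 0 < 1 + P := by linarith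
  have hF : F = -(H * (1 + 2 * P)) := by linarith
  -- By reflection -F + H = 2H(1 + P), and 1 - (P/(1 + P))² = (1 + 2P)/(1 + P)².
  have h2 : 1 / 2 * (1 - (P / (1 + P)) ^ 2) * (-F + H) ^ 2 = 2 * H ^ 2 * (1 + 2 * P) := by
    rw [hF]; field_simp; ring
  rw [h2]
  have hF2 : F ^ 2 = H ^ 2 * (1 + 2 * P) ^ 2 := by rw [hF]; ring
  have h3 : 0 < 1 + 2 * P := by linarith
  rcases le_total (F ^ 2 / k - 1 / 2) 0 with h | h
  · have hPz : P = 0 := by rw [hP, emissionSlope, max_eq_right h]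
    rw [sub_nonpos, div_le_iff₀ hk, hF2, hPz] at h
    refine ⟨?_, by simp [hPz]⟩
    rw [hPz]; linarith
  · have hPe : P = F ^ 2 / k - 1 / 2 := by rw [hP, emissionSlope, max_eq_left h]
    have h4 : (P + 1 / 2) * k = F ^ 2 := by rw [hPe]; field_simp; ring
    have h5 : 2 * H ^ 2 * (1 + 2 * P) = k := by
      rw [hF2] at h4
      have : (1 + 2 * P) * (2 * H ^ 2 * (1 + 2 * P)) = (1 + 2 * P) * k := by linarith
      exact mul_left_cancel₀ h3.ne' this
    exact ⟨h5.le, by rw [h5]; simp⟩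

namespace WaveProfile

variable {κ : ℝ → ℝ} {ℓ₀ S T : ℝ} {L P F H σ : ℝ → ℝ}

lemma hasDerivAt_front (W : WaveProfile κ ℓ₀ S L P F H σ) (t : ℝ) :
    HasDerivAt (fun t => L (σ t)) (P (σ t) / (1 + P (σ t))) t := by
  simpa [div_eq_mul_inv, Function.comp_def] using
    (W.hasDerivAt (σ t)).comp t (W.hasDerivAt_emission t)

lemma continuous_emission (W : WaveProfile κ ℓ₀ S L P F H σ) : Continuous σ :=
  continuous_iff_continuousAt.2 fun t => (W.hasDerivAt_emission t).continuousAt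

lemma emission_monotone (W : WaveProfile κ ℓ₀ S L P F H σ) : Monotone σ :=
  monotone_of_deriv_nonneg (fun t => (W.hasDerivAt_emission t).differentiableAt) fun t => by
    rw [(W.hasDerivAt_emission t).deriv]
    have := W.slope_nonneg (σ t)
    positivity

lemma emission_zero (W : WaveProfile κ ℓ₀ S L P F H σ) : σ 0 = -ℓ₀ := by
  have := W.emission_left_inv (-ℓ₀)
  rwa [W.initial, neg_add_cancel] at this

lemma contDiff_front (W : WaveProfile κ ℓ₀ S L P F H σ) : ContDiff ℝ 1 fun t => L (σ t) := by
  rw [contDiff_one_iff_deriv]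
  refine ⟨fun t => (W.hasDerivAt_front t).differentiableAt, ?_⟩
  rw [show deriv (fun t => L (σ t)) = _ from funext fun t => (W.hasDerivAt_front t).deriv]
  have h1 := W.continuous_slope.comp W.continuous_emission
  refine h1.div (continuous_const.add h1) fun t => ?_
  have := W.slope_nonneg (σ t)
  positivity

lemma front_monotone (W : WaveProfile κ ℓ₀ S L P F H σ) : Monotone fun t => L (σ t) :=
  W.monotone.comp W.emission_monotone

lemma neg_le_emission (W : WaveProfile κ ℓ₀ S L P F H σ) {t : ℝ} (ht : 0 ≤ t) : -ℓ₀ ≤ σ t :=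
  W.emission_zero ▸ W.emission_monotone ht

lemma uniqueDiffOn (W : WaveProfile κ ℓ₀ S L P F H σ) (hT : 0 < T) (hℓ₀ : 0 < ℓ₀) :
    UniqueDiffOn ℝ (closedRegion T fun t => L (σ t)) :=
  uniqueDiffOn_closedRegion hT W.contDiff_front.contDiffOn (W.front_monotone.monotoneOn _)
    (by rw [W.emission_zero, W.initial]; exact hℓ₀)

/-- The displacement vanishes on the front. -/
lemma displacement_front (W : WaveProfile κ ℓ₀ S L P F H σ) {t : ℝ} (ht : 0 ≤ t) :
    displacement ℓ₀ F H (t, L (σ t)) = 0 := by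
  -- Along the front the derivative is exactly the defect in the reflection law, which vanishes for
  -- s ≥ -ℓ₀.
  have hd : ∀ s, HasDerivAt (fun s => displacement ℓ₀ F H (s + L s, L s))
      (F s + H (s + 2 * L s) * (1 + 2 * P s)) s := by
    intro s
    have h1 := (hasFDerivAt_displacement (ℓ₀ := ℓ₀) W.continuous_incoming W.continuous_outgoing
      (s + L s, L s)).comp_hasDerivAt s
      (((hasDerivAt_id s).add (W.hasDerivAt s)).prodMk (W.hasDerivAt s))
    refine h1.congr_deriv ?_
    simp
    ring_nf
  have hz := constant_of_has_deriv_right_zero (a := -ℓ₀) (b := σ t)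
    (f := fun s => displacement ℓ₀ F H (s + L s, L s))
    (fun s _ => (hd s).continuousAt.continuousWithinAt)
    (fun s hs => by
      have h := (hd s).hasDerivWithinAt (s := Ici s)
      rwa [W.reflection s hs.1, add_neg_cancel] at h) (σ t) ⟨W.neg_le_emission ht, le_rfl⟩
  simp only [W.emission_right_inv, W.initial] at hz
  rw [hz]
  simp [displacement]

variable {y₀ y₁ : ℝ → ℝ}

lemma displacement_initial (W : WaveProfile κ ℓ₀ S L P F H σ) (hℓ₀ : 0 < ℓ₀)
    (hF : ∀ s ∈ Icc (-ℓ₀) 0, F s = incoming ℓ₀ y₀ y₁ s)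
    (hH : ∀ x ∈ Icc 0 ℓ₀, H x = 1 / 2 * (y₁ x + derivWithin y₀ (Icc 0 ℓ₀) x))
    (hy₀ : ContDiffOn ℝ 1 y₀ (Icc 0 ℓ₀)) (hy₀' : y₀ ℓ₀ = 0) {x : ℝ} (hx : x ∈ Icc 0 ℓ₀) :
    displacement ℓ₀ F H (0, x) = y₀ x := by
  have hd : ∀ x, HasDerivAt (fun x => displacement ℓ₀ F H (0, x)) (-F (-x) + H x) x := by
    intro x
    have h1 := (hasFDerivAt_displacement (ℓ₀ := ℓ₀) W.continuous_incoming W.continuous_outgoing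
      (0, x)).comp_hasDerivAt x ((hasDerivAt_const x (0 : ℝ)).prodMk (hasDerivAt_id x))
    simpa [Function.comp_def] using h1
  have hconst : ∀ x ∈ Icc 0 ℓ₀, ∀ z ∈ Icc 0 ℓ₀, displacement ℓ₀ F H (0, x) - y₀ x =
      displacement ℓ₀ F H (0, z) - y₀ z := by
    intro x hx z hz
    refine (convex_Icc 0 ℓ₀).is_const_of_fderivWithin_eq_zero (𝕜 := ℝ)
      (f := fun x => displacement ℓ₀ F H (0, x) - y₀ x) ?_ (fun r hr => ?_) hx hz
    · exact fun r hr => ((hd r).differentiableAt.differentiableWithinAt).sub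
        (hy₀.differentiableOn (by simp) r hr)
    · have h1 := (hd r).hasDerivWithinAt.fun_sub
        (hy₀.differentiableOn (by simp) r hr).hasDerivWithinAt
      have h2 : -F (-r) + H r - derivWithin y₀ (Icc 0 ℓ₀) r = 0 := by
        rw [hF (-r) ⟨by linarith [hr.2], by linarith [hr.1]⟩, hH r hr, incoming, neg_neg]
        ring
      rw [h2] at h1
      have h3 := h1.hasFDerivWithinAt.fderivWithin (uniqueDiffOn_Icc hℓ₀ r hr)
      simpa using h3
  have := hconst x hx ℓ₀ ⟨hx.1.trans hx.2, le_rfl⟩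
  rw [hy₀', sub_zero] at this
  have h0 : displacement ℓ₀ F H (0, ℓ₀) = 0 := by simp [displacement]
  linarith

/-- A wave profile that is compatible with the initial data generates a `C¹` solution. -/
theorem isC1Solution (W : WaveProfile κ ℓ₀ S L P F H σ) (hκ : ∀ x ∈ Ici (0 : ℝ), 0 < κ x)
    (hT : 0 < T) (hℓ₀ : 0 < ℓ₀) (hTS : σ T ≤ S)
    (hF : ∀ s ∈ Icc (-ℓ₀) 0, F s = incoming ℓ₀ y₀ y₁ s)
    (hH : ∀ x ∈ Icc 0 ℓ₀, H x = 1 / 2 * (y₁ x + derivWithin y₀ (Icc 0 ℓ₀) x))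
    (hy₀ : ContDiffOn ℝ 1 y₀ (Icc 0 ℓ₀)) (hy₀' : y₀ ℓ₀ = 0) :
    IsC1Solution κ T ℓ₀ y₀ y₁ (fun t => displacement ℓ₀ F H (t, 0)) (fun t => L (σ t))
      (displacement ℓ₀ F H) := by
  have hu := W.uniqueDiffOn hT hℓ₀
  have hder := fun {p : ℝ × ℝ} (hp : p ∈ closedRegion T fun t => L (σ t)) =>
    fderivWithin_displacement (ℓ₀ := ℓ₀) W.continuous_incoming W.continuous_outgoing hu hp
  have hspeed : ∀ t ∈ Ioc 0 T, derivWithin (fun t => L (σ t)) (Icc 0 T) t =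
      P (σ t) / (1 + P (σ t)) := fun t ht =>
    (W.hasDerivAt_front t).hasDerivWithinAt.derivWithin
      (uniqueDiffOn_Icc hT t (Ioc_subset_Icc_self ht))
  have hrate : ∀ t ∈ Ioc 0 T,
      energyReleaseRate T (fun t => L (σ t)) (displacement ℓ₀ F H) t =
        1 / 2 * (1 - (P (σ t) / (1 + P (σ t))) ^ 2) *
          (-F (σ t) + H (σ t + 2 * L (σ t))) ^ 2 := by
    intro t ht
    have hmem : (t, L (σ t)) ∈ closedRegion T fun t => L (σ t) :=
      ⟨ht.1.le, ht.2, hℓ₀.le.trans (W.le_front (W.neg_le_emission ht.1.le)), le_rfl⟩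
    rw [energyReleaseRate, hspeed t ht, (hder hmem).2]
    have e1 : t - L (σ t) = σ t := by linarith [W.emission_right_inv t]
    have e2 : t + L (σ t) = σ t + 2 * L (σ t) := by linarith [W.emission_right_inv t]
    simp only [e1, e2]
  have hgriff : ∀ t ∈ Ioc 0 T, _ := fun t ht =>
    griffith_of_emissionSlope (F := F (σ t)) (H := H (σ t + 2 * L (σ t)))
      (hκ _ (hℓ₀.le.trans (W.le_front (W.neg_le_emission ht.1.le))))
      (W.evolution (σ t) ⟨W.neg_le_emission ht.1.le, (W.emission_monotone ht.2).trans hTS⟩)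
      (W.reflection _ (W.neg_le_emission ht.1.le))
  have h00 : L (σ 0) = ℓ₀ := by rw [W.emission_zero, W.initial]
  refine
    { front_regular := W.contDiff_front.contDiffOn
      disp_regular := (contDiff_displacement W.continuous_incoming W.continuous_outgoing).contDiffOn
      wave := isWeakWave_displacement W.continuous_incoming W.continuous_outgoing
        W.contDiff_front.continuous.continuousOn hu
      left_boundary := fun _ _ => rfl
      front_boundary := fun t ht => W.displacement_front ht.1
      initial_disp := fun x hx => W.displacement_initial hℓ₀ hF hH hy₀ hy₀' hx
      initial_velocity := fun x hx => ?_
      front_initial := h00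
      front_mono := fun t ht => ?_
      griffith_le := fun t ht => by rw [hrate t ht]; exact (hgriff t ht).1
      griffith_eq := fun t ht => by rw [hrate t ht, hspeed t ht]; exact (hgriff t ht).2 }
  · rw [(hder ⟨le_rfl, hT.le, hx.1, by simpa [h00] using hx.2⟩).1]
    simp only [zero_sub, zero_add]
    rw [hF (-x) ⟨by linarith [hx.2], by linarith [hx.1]⟩, hH x hx, incoming, neg_neg]
    ring
  · rw [hspeed t ht]
    have := W.slope_nonneg (σ t)
    positivity

end WaveProfile

/-! ### Uniqueness -/

lemma continuousOn_griffithSpeed {s : Set ℝ} {a k : ℝ → ℝ} (ha : ContinuousOn a s)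
    (hk : ContinuousOn k s) (hpos : ∀ t ∈ s, 0 < k t) :
    ContinuousOn (fun t => griffithSpeed (a t) (k t)) s := by
  unfold griffithSpeed
  refine ContinuousOn.sup (ContinuousOn.div ?_ ?_ fun t ht => ?_) continuousOn_const
  · exact (continuousOn_const.mul (ha.pow 2)).sub hk
  · exact (continuousOn_const.mul (ha.pow 2)).add hk
  · have := hpos t ht
    positivity

namespace IsC1Solution

variable {κ : ℝ → ℝ} {T ℓ₀ : ℝ} {y₀ y₁ u ℓ : ℝ → ℝ} {y : ℝ × ℝ → ℝ}

/-- Griffith's criterion is imposed only for t > 0; continuity of both sides supplies t = 0. -/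
lemma speed_eq_of_mem_Icc (h : IsC1Solution κ T ℓ₀ y₀ y₁ u ℓ y) (hT : 0 < T) (hℓ₀ : 0 < ℓ₀)
    (hκ : ∀ x ∈ Ici (0 : ℝ), 0 < κ x) (hκc : ContinuousOn κ (Ici 0)) {t : ℝ} (ht : t ∈ Icc 0 T) :
    derivWithin ℓ (Icc 0 T) t =
      griffithSpeed ((dt T ℓ y (t, ℓ t) - dx T ℓ y (t, ℓ t)) / 2) (κ (ℓ t)) := by
  have hpos : ∀ t ∈ Icc 0 T, ℓ t ∈ Ici 0 := fun t ht => hℓ₀.le.trans (h.le_front hT ht)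
  have hd := h.disp_regular.continuousOn_fderivWithin (h.uniqueDiffOn hT hℓ₀) le_rfl
  have hγ : ContinuousOn (fun t => (t, ℓ t)) (Icc 0 T) :=
    continuousOn_id.prodMk h.front_regular.continuousOn
  have hd' := hd.comp hγ fun t ht => h.front_mem hT hℓ₀ ht
  have hEq : EqOn (derivWithin ℓ (Icc 0 T)) (fun t =>
      griffithSpeed ((dt T ℓ y (t, ℓ t) - dx T ℓ y (t, ℓ t)) / 2) (κ (ℓ t))) (Ioc 0 T) :=
    fun t ht => h.speed_eq hT hℓ₀ hκ ht
  refine hEq.of_subset_closure (h.front_regular.continuousOn_derivWithin (uniqueDiffOn_Icc hT)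
    le_rfl) (continuousOn_griffithSpeed ?_ ?_ fun t ht => hκ _ (hpos t ht)) Ioc_subset_Icc_self
    (by rw [closure_Ioc hT.ne]) ht
  · exact ((hd'.clm_apply continuousOn_const).sub (hd'.clm_apply continuousOn_const)).div_const 2
  · exact hκc.comp h.front_regular.continuousOn hpos

end IsC1Solution

namespace WaveProfile

variable {κ : ℝ → ℝ} {ℓ₀ S T c₁ : ℝ} {L P F H σ : ℝ → ℝ} {y₀ y₁ ℓ : ℝ → ℝ} {y : ℝ × ℝ → ℝ}

section

variable {u : ℝ → ℝ}

/-- As long as the incoming derivative of a solution is that of the profile, its front is that of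
the profile. -/
lemma front_eq_of_incoming_eq (W : WaveProfile κ ℓ₀ S L P F H σ) (hc₁ : 0 < c₁)
    (hκ : ∀ x ∈ Ici (0 : ℝ), c₁ ≤ κ x) (hκ_lip : LocallyLipschitzOn (Ici (0 : ℝ)) κ)
    (hT : 0 < T) (hℓ₀ : 0 < ℓ₀) (hTS : σ T ≤ S)
    (h : IsC1Solution κ T ℓ₀ y₀ y₁ u ℓ y) {s₀ : ℝ}
    (hin : ∀ t x, (t, x) ∈ closedRegion T ℓ → t - x ≤ s₀ →
      dt T ℓ y (t, x) - dx T ℓ y (t, x) = 2 * F (t - x))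
    {t : ℝ} (ht : t ∈ Icc 0 T) (hs : t - ℓ t ≤ s₀) : t - ℓ t = σ t ∧ ℓ t = L (σ t) ∧
      derivWithin ℓ (Icc 0 T) t = P (σ t) / (1 + P (σ t)) := by
  have hκ0 : ∀ x ∈ Ici (0 : ℝ), 0 < κ x := fun x hx => hc₁.trans_le (hκ x hx)
  have hmono := h.strictMonoOn_sub hT hℓ₀ hκ0
  have hspeed : ∀ r ∈ Icc 0 T, r - ℓ r ≤ s₀ → derivWithin ℓ (Icc 0 T) r =
      griffithSpeed (F (r - ℓ r)) (κ (ℓ r)) := by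
    intro r hr hrs
    rw [h.speed_eq_of_mem_Icc hT hℓ₀ hκ0 hκ_lip.continuousOn hr,
      hin r _ (h.front_mem hT hℓ₀ hr) hrs, mul_div_cancel_left₀ _ two_ne_zero]
  have hfront : ∀ c ∈ Icc 0 T, c - ℓ c ≤ s₀ → c - ℓ c ≤ S → ℓ c = L (c - ℓ c) := by
    intro c hc hcs hcS
    refine W.eq_of_griffithSpeed hℓ₀ hc₁ hκ hκ_lip hc.1 h.front_initial (fun r hr => ?_) hcS
      (right_mem_Icc.2 hc.1)
    have hr' : r ∈ Icc 0 T := ⟨hr.1, hr.2.trans hc.2⟩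
    rw [← hspeed r hr' ((hmono.monotoneOn hr' hc hr.2).trans hcs)]
    exact (h.hasDerivWithinAt hr').mono (Icc_subset_Icc_right hc.2)
  -- Otherwise the front passes s = S at some c ≤ t, with c = S + L(S) ≥ σ(T) + L(σ(T)) = T. Then c
  -- = t, a contradiction.
  have hS : t - ℓ t ≤ S := by
    by_contra! hlt
    have h0 : -ℓ₀ ≤ S := (W.neg_le_emission hT.le).trans hTS
    obtain ⟨c, hc, hcS⟩ := intermediate_value_Icc ht.1
      (f := fun t => t - ℓ t) ((continuousOn_id.sub h.front_regular.continuousOn).mono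
        (Icc_subset_Icc_right ht.2)) (show S ∈ Icc _ _ from
        ⟨by simp only [h.front_initial]; linarith, hlt.le⟩)
    simp only at hcS
    have hc' : c ∈ Icc 0 T := ⟨hc.1, hc.2.trans ht.2⟩
    have h1 := hfront c hc' (by linarith) hcS.le
    rw [hcS] at h1
    have h2 := W.emission_right_inv T
    have h3 := W.monotone hTS
    have h4 : c = t := le_antisymm hc.2 (by linarith [ht.2])
    rw [h4] at hcS
    linarith
  have hℓ := hfront t ht hs hS
  have hσ : t - ℓ t = σ t := by
    have := W.emission_left_inv (t - ℓ t)
    rwa [← hℓ, sub_add_cancel, eq_comm] at this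
  have hℓ' : ℓ t = L (σ t) := by rw [← hσ]; exact hℓ
  refine ⟨hσ, hℓ', ?_⟩
  have hσ0 := W.neg_le_emission ht.1
  rw [hspeed t ht hs, griffithSpeed_eq_emissionSlope_div _
    (hκ0 _ (hℓ₀.le.trans (h.le_front hT ht))), hσ, hℓ',
    ← W.evolution _ ⟨hσ0, hσ ▸ hS⟩]

/-- As long as the incoming derivative of a solution is that of the profile, its outgoing derivative
is that of the profile. -/
lemma outgoing_eq_of_incoming_eq (W : WaveProfile κ ℓ₀ S L P F H σ) (hc₁ : 0 < c₁)
    (hκ : ∀ x ∈ Ici (0 : ℝ), c₁ ≤ κ x) (hκ_lip : LocallyLipschitzOn (Ici (0 : ℝ)) κ)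
    (hT : 0 < T) (hℓ₀ : 0 < ℓ₀) (hTS : σ T ≤ S)
    (hH : ∀ x ∈ Icc 0 ℓ₀, H x = 1 / 2 * (y₁ x + derivWithin y₀ (Icc 0 ℓ₀) x))
    (h : IsC1Solution κ T ℓ₀ y₀ y₁ u ℓ y) {s₀ : ℝ}
    (hin : ∀ t x, (t, x) ∈ closedRegion T ℓ → t - x ≤ s₀ →
      dt T ℓ y (t, x) - dx T ℓ y (t, x) = 2 * F (t - x))
    {t x : ℝ} (hp : (t, x) ∈ closedRegion T ℓ) (hs : t + x ≤ s₀ + 2 * ℓ₀) :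
    dt T ℓ y (t, x) + dx T ℓ y (t, x) = 2 * H (t + x) := by
  have hp' := hp
  obtain ⟨ht0, htT, hx0, hxℓ⟩ := hp'
  simp only at ht0 htT hx0 hxℓ
  rcases le_total (t + x) ℓ₀ with hz | hz
  · have hmem : t + x ∈ Icc 0 ℓ₀ := ⟨by linarith, hz⟩
    rw [h.outgoing_initial hT hℓ₀ hp hz, h.initial_velocity _ hmem, h.dx_initial hT hℓ₀ hmem,
      hH _ hmem]
    ring
  · obtain ⟨t', ht', hz'⟩ := intermediate_value_Icc ht0
      (f := fun t => t + ℓ t) ((continuousOn_id.add h.front_regular.continuousOn).mono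
        (Icc_subset_Icc_right htT)) (show t + x ∈ Icc _ _ from
        ⟨by simpa [h.front_initial] using hz, by simpa using hxℓ⟩)
    simp only at hz'
    have ht'T : t' ∈ Icc 0 T := ⟨ht'.1, ht'.2.trans htT⟩
    -- This is the gain of one round trip: t' - ℓ(t') = t + x - 2ℓ(t'), and the front never lies
    -- below ℓ₀.
    have hsle : t' - ℓ t' ≤ s₀ := by linarith [h.le_front hT ht'T]
    obtain ⟨hσ, hℓ, hv⟩ := W.front_eq_of_incoming_eq hc₁ hκ hκ_lip hT hℓ₀ hTS h hin ht'T hsle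
    rw [h.outgoing_front hT hℓ₀ hp ht'T hz']
    have e1 := hin t' _ (h.front_mem hT hℓ₀ ht'T) hsle
    have e2 := h.front_relation hT hℓ₀ ht'T
    have e3 := W.reflection (σ t') (W.neg_le_emission ht'.1)
    have hP := W.slope_nonneg (σ t')
    rw [hv] at e2
    rw [hσ] at e1
    rw [← hz', show t' + ℓ t' = σ t' + 2 * L (σ t') by linarith]
    set yt := dt T ℓ y (t', ℓ t')
    set yx := dx T ℓ y (t', ℓ t')
    have h1 : 0 < 1 + P (σ t') := by linarith
    have h2 : 0 < 1 + 2 * P (σ t') := by linarith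
    field_simp at e2
    refine mul_right_cancel₀ h2.ne' ?_
    linear_combination 2 * e2 - e1 - 2 * e3

end

/-- The solution generated by a wave profile is the only one with its boundary control. -/
theorem unique (W : WaveProfile κ ℓ₀ S L P F H σ) (hc₁ : 0 < c₁)
    (hκ : ∀ x ∈ Ici (0 : ℝ), c₁ ≤ κ x) (hκ_lip : LocallyLipschitzOn (Ici (0 : ℝ)) κ)
    (hT : 0 < T) (hℓ₀ : 0 < ℓ₀) (hTS : σ T ≤ S)
    (hF : ∀ s ∈ Icc (-ℓ₀) 0, F s = incoming ℓ₀ y₀ y₁ s)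
    (hH : ∀ x ∈ Icc 0 ℓ₀, H x = 1 / 2 * (y₁ x + derivWithin y₀ (Icc 0 ℓ₀) x))
    (h : IsC1Solution κ T ℓ₀ y₀ y₁ (fun t => displacement ℓ₀ F H (t, 0)) ℓ y) :
    EqOn ℓ (fun t => L (σ t)) (Icc 0 T) ∧
      EqOn y (displacement ℓ₀ F H) (closedRegion T fun t => L (σ t)) := by
  have hκ0 : ∀ x ∈ Ici (0 : ℝ), 0 < κ x := fun x hx => hc₁.trans_le (hκ x hx)
  have haxis : ∀ s ∈ Icc 0 T, dt T ℓ y (s, 0) = F s + H s := by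
    intro s hs
    rw [h.dt_axis hT hℓ₀ hs]
    have h1 := (hasFDerivAt_displacement (ℓ₀ := ℓ₀) W.continuous_incoming W.continuous_outgoing
      (s, 0)).comp_hasDerivAt s ((hasDerivAt_id s).prodMk (hasDerivAt_const s (0 : ℝ)))
    have h2 := h1.hasDerivWithinAt.derivWithin (uniqueDiffOn_Icc hT s hs)
    simpa [Function.comp_def] using h2
  have hin : ∀ n : ℕ, ∀ t x, (t, x) ∈ closedRegion T ℓ → t - x ≤ n * (2 * ℓ₀) →
      dt T ℓ y (t, x) - dx T ℓ y (t, x) = 2 * F (t - x) := by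
    have hneg : ∀ t x, (t, x) ∈ closedRegion T ℓ → t ≤ x →
        dt T ℓ y (t, x) - dx T ℓ y (t, x) = 2 * F (t - x) := by
      intro t x hp htx
      obtain ⟨hmem, heq⟩ := h.incoming_initial hT hℓ₀ hκ0 hp htx
      rw [heq, h.initial_velocity _ hmem, h.dx_initial hT hℓ₀ hmem,
        hF (t - x) ⟨by linarith [hmem.2], by linarith⟩, incoming, neg_sub]
      ring
    intro n
    induction n with
    | zero => exact fun t x hp hs => hneg t x hp (by simpa using hs)
    | succ n ih =>
      intro t x hp hs
      rcases le_total t x with htx | htx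
      · exact hneg t x hp htx
      -- On the axis the control prescribes ∂ₜy = F + H, and the induction hypothesis gives ∂ₜy +
      -- ∂ₓy = 2H there, so ∂ₜy - ∂ₓy = 2F.
      · rw [h.incoming_axis hT hℓ₀ hκ0 hp htx]
        have hs' : t - x ∈ Icc 0 T := ⟨by linarith, by linarith [hp.2.1, hp.2.2.1]⟩
        have h1 := W.outgoing_eq_of_incoming_eq hc₁ hκ hκ_lip hT hℓ₀ hTS hH h ih
          (h.axis_mem hT hℓ₀ hs') (by push_cast at hs; linarith)
        rw [add_zero] at h1
        linarith [haxis _ hs']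
  have hin' : ∀ t x, (t, x) ∈ closedRegion T ℓ → t - x ≤ T →
      dt T ℓ y (t, x) - dx T ℓ y (t, x) = 2 * F (t - x) := by
    obtain ⟨n, hn⟩ := exists_nat_ge (T / (2 * ℓ₀))
    rw [div_le_iff₀ (by positivity)] at hn
    exact fun t x hp hs => hin n t x hp (hs.trans hn)
  have hfront : EqOn ℓ (fun t => L (σ t)) (Icc 0 T) := fun t ht =>
    (W.front_eq_of_incoming_eq hc₁ hκ hκ_lip hT hℓ₀ hTS h hin' ht
      (by linarith [h.le_front hT ht, ht.2])).2.1
  refine ⟨hfront, ?_⟩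
  have hout : ∀ t x, (t, x) ∈ closedRegion T ℓ →
      dt T ℓ y (t, x) + dx T ℓ y (t, x) = 2 * H (t + x) := by
    -- The bound T + ℓ(T) is never active; it is large enough for t + x to be covered everywhere in
    -- the region.
    have hin2 : ∀ t x, (t, x) ∈ closedRegion T ℓ → t - x ≤ T + ℓ T →
        dt T ℓ y (t, x) - dx T ℓ y (t, x) = 2 * F (t - x) := fun t x hp _ =>
      hin' t x hp (by linarith [hp.2.1, hp.2.2.1])
    intro t x hp
    refine W.outgoing_eq_of_incoming_eq hc₁ hκ hκ_lip hT hℓ₀ hTS hH h hin2 hp ?_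
    have := h.monotoneOn ⟨hp.1, hp.2.1⟩ (right_mem_Icc.2 hT.le) hp.2.1
    linarith [hp.2.1, hp.2.2.2]
  rintro ⟨t, x⟩ ⟨ht0, htT, hx0, hxℓ⟩
  simp only at ht0 htT hx0 hxℓ
  have ht : t ∈ Icc 0 T := ⟨ht0, htT⟩
  replace hxℓ : x ≤ ℓ t := hxℓ.trans_eq (hfront ht).symm
  have hd : ∀ z ∈ Icc 0 (ℓ t), HasDerivWithinAt (fun z => y (t, z) - displacement ℓ₀ F H (t, z)) 0
      (Icc 0 (ℓ t)) z := by
    intro z hz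
    have hp : (t, z) ∈ closedRegion T ℓ := ⟨ht0, htT, hz.1, hz.2⟩
    have h1 := h.hasDerivWithinAt_vertical ht hz
    have h2 := (hasFDerivAt_displacement (ℓ₀ := ℓ₀) W.continuous_incoming W.continuous_outgoing
      (t, z)).comp_hasDerivAt z ((hasDerivAt_const z t).prodMk (hasDerivAt_id z))
    refine (h1.sub h2.hasDerivWithinAt).congr_deriv ?_
    have e1 := hin' t z hp (by linarith [hz.1])
    have e2 := hout t z hp
    simp
    linarith
  have hconst := constant_of_has_deriv_right_zero
    (fun z hz => (hd z hz).continuousWithinAt) fun z hz =>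
      (hd z (Ico_subset_Icc_self hz)).mono_of_mem_nhdsWithin (Icc_mem_nhdsGE_of_mem hz)
  have hend := hconst (ℓ t) ⟨hx0.trans hxℓ, le_rfl⟩
  have hx := hconst x ⟨hx0, hxℓ⟩
  rw [h.front_boundary t ht, show ℓ t = L (σ t) from hfront ht, W.displacement_front ht0] at hend
  linarith

end WaveProfile

/-! ### Existence of front profiles -/

lemma exists_continuous_eqOn_Icc {f : ℝ → ℝ} {a b : ℝ} (hab : a ≤ b)
    (hf : ContinuousOn f (Icc a b)) : ∃ g, Continuous g ∧ EqOn g f (Icc a b) := by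
  refine ⟨fun x => f (max a (min x b)), hf.comp_continuous (by fun_prop) fun x =>
    ⟨le_max_left _ _, max_le hab (min_le_right _ _)⟩, fun x hx => ?_⟩
  simp only [min_eq_left hx.2, max_eq_right hx.1]

/-- The ordinary differential equation of the initial branch in the emission coordinate. -/
lemma exists_emission_ode_solution {κ : ℝ → ℝ} {c₁ ℓ₀ : ℝ} (hc₁ : 0 < c₁) (hℓ₀ : 0 < ℓ₀)
    (hκ : ∀ x, c₁ ≤ κ x) (hκ_lip : LocallyLipschitz κ) {F : ℝ → ℝ} (hF : Continuous F) :
    ∃ Λ : ℝ → ℝ, Λ (-ℓ₀) = ℓ₀ ∧ ∀ s ∈ Icc (-ℓ₀) 0,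
      HasDerivWithinAt Λ (emissionSlope (F s) (κ (Λ s))) (Icc (-ℓ₀) 0) s := by
  have hneg : -ℓ₀ ≤ 0 := by linarith
  obtain ⟨B, hB⟩ := isCompact_Icc.exists_bound_of_continuousOn
    (hF.continuousOn (s := Icc (-ℓ₀) 0))
  obtain ⟨M, hM⟩ : ∃ M : NNReal, (M : ℝ) = B ^ 2 / c₁ :=
    ⟨_, Real.coe_toNNReal _ (by positivity)⟩
  obtain ⟨C, hC⟩ : ∃ C : NNReal, (C : ℝ) = B ^ 2 / c₁ ^ 2 :=
    ⟨_, Real.coe_toNNReal _ (by positivity)⟩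
  -- The slope bound M holds for all positions, so the radius a = Mℓ₀ can be taken large enough for
  -- existence on the whole interval of length ℓ₀.
  obtain ⟨a, ha⟩ : ∃ a : NNReal, (a : ℝ) = M * ℓ₀ :=
    ⟨_, Real.coe_toNNReal _ (by positivity)⟩
  obtain ⟨K, hK⟩ := (hκ_lip.locallyLipschitzOn
    (s := Metric.closedBall ℓ₀ a)).exists_lipschitzOnWith_of_compact (isCompact_closedBall _ _)
  have hPL : IsPicardLindelof (fun s l => emissionSlope (F s) (κ l)) (tmin := -ℓ₀) (tmax := 0)
      ⟨-ℓ₀, le_rfl, hneg⟩ ℓ₀ a 0 M (C * K) := by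
    refine ⟨fun s hs => LipschitzOnWith.of_dist_le_mul fun l hl l' hl' => ?_, fun l _ => ?_,
      fun s hs l _ => ?_, ?_⟩
    · refine (abs_emissionSlope_sub_le hc₁ (hB s hs) (hκ l) (hκ l')).trans ?_
      rw [NNReal.coe_mul, mul_assoc, hC]
      exact mul_le_mul_of_nonneg_left (hK.dist_le_mul _ hl _ hl') (by positivity)
    · unfold emissionSlope
      exact (((hF.pow 2).div_const _).sub continuous_const |>.max continuous_const).continuousOn
    · rw [Real.norm_eq_abs, abs_of_nonneg (emissionSlope_nonneg _ _)]
      refine max_le ?_ M.coe_nonneg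
      have h1 : F s ^ 2 ≤ B ^ 2 := sq_le_sq' (neg_le_of_abs_le (hB s hs)) (le_of_abs_le (hB s hs))
      have h2 : F s ^ 2 / κ l ≤ B ^ 2 / c₁ := div_le_div₀ (sq_nonneg B) h1 hc₁ (hκ l)
      linarith
    · simp [ha, hℓ₀.le]
  exact hPL.exists_eq_forall_mem_Icc_hasDerivWithinAt₀

/-- The profile of the initial branch. -/
lemma exists_initial_profile {κ : ℝ → ℝ} {c₁ ℓ₀ : ℝ} (hc₁ : 0 < c₁) (hℓ₀ : 0 < ℓ₀)
    (hκ : ∀ x ∈ Ici (0 : ℝ), c₁ ≤ κ x) (hκ_lip : LocallyLipschitzOn (Ici (0 : ℝ)) κ)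
    {F : ℝ → ℝ} (hF : Continuous F) : ∃ L P, FrontProfile κ ℓ₀ 0 L P F := by
  have hneg : -ℓ₀ ≤ 0 := by linarith
  -- The toughness is extended to negative positions by its value at 0; the truncation is removed at
  -- the end since L ≥ ℓ₀.
  have hκ' : ∀ l, c₁ ≤ κ (max l 0) := fun l => hκ _ (mem_Ici.2 (le_max_right _ _))
  have hlip : LocallyLipschitz fun l => κ (max l 0) := by
    rw [← locallyLipschitzOn_univ]
    have h1 : LipschitzWith 1 fun l : ℝ => max l 0 := LipschitzWith.id.max_const 0
    intro l _
    obtain ⟨K, t, ht, hK⟩ := hκ_lip (mem_Ici.2 (le_max_right l 0))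
    refine ⟨K * 1, (fun l => max l 0) ⁻¹' t, ?_, hK.comp h1.lipschitzOnWith fun _ hx => hx⟩
    have h2 : Tendsto (fun l : ℝ => max l 0) (𝓝[univ] l) (𝓝[Ici 0] (max l 0)) := by
      rw [nhdsWithin_univ]
      exact tendsto_nhdsWithin_iff.2 ⟨h1.continuous.tendsto l,
        Eventually.of_forall fun x => mem_Ici.2 (le_max_right _ _)⟩
    exact h2 ht
  obtain ⟨Λ, hΛ0, hΛ⟩ := exists_emission_ode_solution hc₁ hℓ₀ hκ' hlip hF
  have hΛc : ContinuousOn Λ (Icc (-ℓ₀) 0) := fun s hs => (hΛ s hs).continuousWithinAt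
  -- The slope is extended to a continuous nonnegative function on the line. Its primitive is then a
  -- globally C¹ front that agrees with Λ on [-ℓ₀, 0].
  obtain ⟨P, hP, hP0, hPf⟩ : ∃ P : ℝ → ℝ, Continuous P ∧ (∀ s, 0 ≤ P s) ∧
      ∀ s ∈ Icc (-ℓ₀) 0, P s = emissionSlope (F s) (κ (max (Λ s) 0)) := by
    obtain ⟨P, hP, hPe⟩ := exists_continuous_eqOn_Icc hneg
      (f := fun s => F s ^ 2 / κ (max (Λ s) 0) - 1 / 2)
      (((hF.continuousOn.pow 2).div (hlip.continuous.comp_continuousOn hΛc)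
        fun s _ => (hc₁.trans_le (hκ' (Λ s))).ne').sub continuousOn_const)
    exact ⟨fun s => max (P s) 0, hP.max continuous_const, fun s => le_max_right _ _, fun s hs => by
      simp only [hPe hs, emissionSlope]⟩
  have hL : ∀ s, HasDerivAt (fun s => ℓ₀ + ∫ r in (-ℓ₀)..s, P r) (P s) s := fun s =>
    (hasDerivAt_integral_of_continuous hP (-ℓ₀) s).const_add ℓ₀
  have hΛL : ∀ s ∈ Icc (-ℓ₀) 0, (ℓ₀ + ∫ r in (-ℓ₀)..s, P r) = Λ s := by
    intro s hs
    have hd : ∀ s ∈ Icc (-ℓ₀) 0, HasDerivWithinAt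
        (fun s => (ℓ₀ + ∫ r in (-ℓ₀)..s, P r) - Λ s) 0 (Icc (-ℓ₀) 0) s := fun s hs => by
      have := (hL s).hasDerivWithinAt.fun_sub (hΛ s hs)
      rwa [hPf s hs, sub_self] at this
    have := constant_of_has_deriv_right_zero
      (fun z hz => (hd z hz).continuousWithinAt) (fun z hz =>
        (hd z (Ico_subset_Icc_self hz)).mono_of_mem_nhdsWithin (Icc_mem_nhdsGE_of_mem hz)) s hs
    simp only [intervalIntegral.integral_same, add_zero, hΛ0, sub_self] at this
    linarith
  have hmono : Monotone fun s => ℓ₀ + ∫ r in (-ℓ₀)..s, P r :=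
    monotone_of_deriv_nonneg (fun s => (hL s).differentiableAt) fun s => by
      rw [(hL s).deriv]; exact hP0 s
  refine ⟨fun s => ℓ₀ + ∫ r in (-ℓ₀)..s, P r, P, hP, hF, hL, hP0, by simp, fun s hs => ?_⟩
  have h1 := hmono hs.1
  simp only [intervalIntegral.integral_same, add_zero] at h1
  rw [hPf s hs, ← hΛL s hs, max_eq_left (hℓ₀.le.trans h1)]

/-- A nonnegative slope with given initial value and given integral. -/
lemma exists_slope {S m D : ℝ} (hS : 0 < S) (hm : 0 ≤ m) (hD : 0 ≤ D) (hmD : m = 0 ∨ 0 < D) :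
    ∃ p : ℝ → ℝ, Continuous p ∧ (∀ s, 0 ≤ p s) ∧ p 0 = m ∧ (∀ s, 2 * S / 3 ≤ s → p s = 0) ∧
      (m = 0 → ∀ s ≤ S / 3, p s = 0) ∧ ∫ s in (0 : ℝ)..S, p s = D := by
  -- The slope is a ramp of height m and width δ plus a multiple of a bump on the middle third. As
  -- mδ ≤ D the ramp does not exceed the prescribed integral, and the bump supplies the rest.
  obtain ⟨δ, hδ0, hδS, hδD⟩ : ∃ δ, 0 < δ ∧ δ ≤ S / 3 ∧ m * δ ≤ D := by
    rcases hmD with rfl | hD'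
    · exact ⟨S / 3, by positivity, le_rfl, by simpa using hD⟩
    · refine ⟨min (S / 3) (D / (m + 1)), by positivity, min_le_left _ _, ?_⟩
      calc m * min (S / 3) (D / (m + 1)) ≤ (m + 1) * (D / (m + 1)) :=
            mul_le_mul (by linarith) (min_le_right _ _) (by positivity) (by positivity)
        _ = D := by field_simp
  set q : ℝ → ℝ := fun s => m * max (1 - s / δ) 0 with hq
  set b : ℝ → ℝ := fun s => max ((s - S / 3) * (2 * S / 3 - s)) 0 with hb
  have hqc : Continuous q := by fun_prop
  have hbc : Continuous b := by fun_prop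
  have hb0 : ∀ s, 0 ≤ b s := fun s => le_max_right _ _
  have hq0 : ∀ s, 0 ≤ q s := fun s => mul_nonneg hm (le_max_right _ _)
  have hbl : ∀ s ≤ S / 3, b s = 0 := fun s hs => max_eq_right (by nlinarith)
  have hbr : ∀ s, 2 * S / 3 ≤ s → b s = 0 := fun s hs => max_eq_right (by nlinarith)
  have hqr : ∀ s, δ ≤ s → q s = 0 := fun s hs => by
    have : 1 - s / δ ≤ 0 := by rw [sub_nonpos, le_div_iff₀ hδ0]; linarith
    simp [hq, max_eq_right this]
  have hI : 0 < ∫ s in (0 : ℝ)..S, b s := by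
    refine intervalIntegral.integral_pos hS hbc.continuousOn (fun s _ => hb0 s)
      ⟨S / 2, ⟨by linarith, by linarith⟩, lt_max_of_lt_left ?_⟩
    have : 0 < S ^ 2 := by positivity
    nlinarith
  have hJ : ∫ s in (0 : ℝ)..S, q s ≤ D := by
    rw [← intervalIntegral.integral_add_adjacent_intervals (b := δ)
      (hqc.intervalIntegrable _ _) (hqc.intervalIntegrable _ _)]
    have h1 : ∫ s in δ..S, q s = 0 := by
      rw [intervalIntegral.integral_congr (g := fun _ => (0 : ℝ)), intervalIntegral.integral_zero]
      intro s hs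
      rw [uIcc_of_le (by linarith)] at hs
      exact hqr s hs.1
    have h2 : ∫ s in (0 : ℝ)..δ, q s ≤ ∫ s in (0 : ℝ)..δ, m := by
      refine intervalIntegral.integral_mono_on hδ0.le (hqc.intervalIntegrable _ _)
        (continuous_const.intervalIntegrable _ _) fun s hs => ?_
      have : max (1 - s / δ) 0 ≤ 1 := max_le (by
        have : 0 ≤ s / δ := div_nonneg hs.1 hδ0.le
        linarith) zero_le_one
      simpa using mul_le_mul_of_nonneg_left this hm
    rw [intervalIntegral.integral_const, sub_zero, smul_eq_mul] at h2
    linarith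
  set A : ℝ := (D - ∫ s in (0 : ℝ)..S, q s) / ∫ s in (0 : ℝ)..S, b s with hA
  have hA0 : 0 ≤ A := div_nonneg (by linarith) hI.le
  refine ⟨fun s => q s + A * b s, by fun_prop, fun s => ?_, ?_, fun s hs => ?_, fun hm0 s hs => ?_,
    ?_⟩
  · exact add_nonneg (hq0 s) (mul_nonneg hA0 (hb0 s))
  · simp [hbl 0 (by positivity), hq]
  · simp [hbr s hs, hqr s (by linarith)]
  · simp [hbl s hs, hq, hm0]
  · have hAb : Continuous fun s => A * b s := by fun_prop
    have hAI : ∫ s in (0 : ℝ)..S, A * b s = A * ∫ s in (0 : ℝ)..S, b s :=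
      intervalIntegral.integral_const_mul _ _
    rw [intervalIntegral.integral_add (hqc.intervalIntegrable _ _) (hAb.intervalIntegrable _ _),
      hAI, div_mul_cancel₀ _ hI.ne', add_sub_cancel]

/-- A continuous path in `[-1, 1]` that stays at `θ` in the middle third of `[0, S]`. -/
lemma exists_path {S θ₀ θ θ₁ : ℝ} (hS : 0 < S) (h0 : |θ₀| ≤ 1) (h : |θ| ≤ 1) (h1 : |θ₁| ≤ 1) :
    ∃ τ : ℝ → ℝ, Continuous τ ∧ τ 0 = θ₀ ∧ τ S = θ₁ ∧ (∀ s ∈ Icc (S / 3) (2 * S / 3), τ s = θ) ∧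
      (∀ s, |τ s| ≤ 1) ∧ (θ₀ = θ → ∀ s ≤ 2 * S / 3, τ s = θ) := by
  -- Clamping to [0, 1]. The path moves from θ₀ to θ on the first third of [0, S] and from θ to θ₁
  -- on the last third.
  set k : ℝ → ℝ := fun x => max 0 (min x 1) with hk
  have hk0 : ∀ x, 0 ≤ k x := fun x => le_max_left _ _
  have hk1 : ∀ x, k x ≤ 1 := fun x => max_le zero_le_one (min_le_right _ _)
  have hkl : ∀ x ≤ 0, k x = 0 := fun x hx => max_eq_left ((min_le_left _ _).trans hx)
  have hkr : ∀ x, 1 ≤ x → k x = 1 := fun x hx => by simp [hk, min_eq_right hx]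
  have hS3 : S * 3 / S = 3 := by field_simp
  have e1 : ∀ s ≤ 2 * S / 3, k (s * 3 / S - 2) = 0 := fun s hs =>
    hkl _ (by rw [sub_nonpos, div_le_iff₀ hS]; linarith)
  have e2 : ∀ s, S / 3 ≤ s → k (s * 3 / S) = 1 := fun s hs =>
    hkr _ (by rw [le_div_iff₀ hS]; linarith)
  have hconv : ∀ a b c : ℝ, |a| ≤ 1 → |b| ≤ 1 → 0 ≤ c → c ≤ 1 → |a + (b - a) * c| ≤ 1 := by
    intro a b c ha hb hc hc'
    rw [abs_le] at ha hb ⊢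
    constructor <;> nlinarith [ha.1, ha.2, hb.1, hb.2]
  refine ⟨fun s => θ₀ + (θ - θ₀) * k (s * 3 / S) + (θ₁ - θ) * k (s * 3 / S - 2), by fun_prop, ?_,
    ?_, fun s hs => ?_, fun s => ?_, fun hθ s hs => ?_⟩
  · simp [hkl]
  · simp only [hS3]
    rw [hkr 3 (by norm_num), hkr (3 - 2) (by norm_num)]; ring
  · simp only [e1 s hs.2, e2 s hs.1]; ring
  · rcases le_total s (2 * S / 3) with hs | hs
    · simp only [e1 s hs, mul_zero, add_zero]
      exact hconv _ _ _ h0 h (hk0 _) (hk1 _)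
    · simp only [e2 s (by linarith), mul_one, add_sub_cancel]
      exact hconv _ _ _ h h1 (hk0 _) (hk1 _)
  · simp only [e1 s hs, hθ, sub_self, zero_mul, mul_zero, add_zero]

/-- Inverts the front equation for F. A moving front fixes F up to sign, while a front at rest only
needs F² ≤ k/2, so the factor τ is then free in [-1, 1]. -/
lemma emissionSlope_mul_sqrt {τ k p : ℝ} (hk : 0 < k) (hp : 0 ≤ p) (hτ : |τ| ≤ 1)
    (hτ' : p ≠ 0 → |τ| = 1) : emissionSlope (τ * √(k * (p + 1 / 2))) k = p := by
  have h1 : 0 ≤ k * (p + 1 / 2) := by positivity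
  have h2 : (τ * √(k * (p + 1 / 2))) ^ 2 / k = τ ^ 2 * (p + 1 / 2) := by
    rw [mul_pow, Real.sq_sqrt h1]; field_simp
  rw [emissionSlope, h2]
  by_cases hp0 : p = 0
  · have : τ ^ 2 ≤ 1 := (sq_le_one_iff_abs_le_one τ).2 hτ
    rw [hp0, max_eq_right]
    linarith
  · have : τ ^ 2 = 1 := by rw [← sq_abs, hτ' hp0, one_pow]
    rw [this, one_mul, add_sub_cancel_right, max_eq_left hp]

/-- The initial branch can be continued to a front that reaches a prescribed position, from where
the incoming derivative is prescribed. -/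
lemma FrontProfile.exists_extension {κ : ℝ → ℝ} {c₁ ℓ₀ S S' ℓbar : ℝ} {L₀ P₀ F₀ F₂ : ℝ → ℝ}
    (W : FrontProfile κ ℓ₀ 0 L₀ P₀ F₀) (hc₁ : 0 < c₁) (hℓ₀ : 0 < ℓ₀)
    (hκ : ∀ x ∈ Ici (0 : ℝ), c₁ ≤ κ x) (hκc : ContinuousOn κ (Ici 0)) (hS : 0 < S) (hSS' : S ≤ S')
    (hℓ : P₀ 0 = 0 ∧ L₀ 0 ≤ ℓbar ∨ L₀ 0 < ℓbar) (hF₂ : Continuous F₂)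
    (hb : ∀ s ∈ Icc S S', F₂ s ^ 2 ≤ κ ℓbar / 2) :
    ∃ L P F, FrontProfile κ ℓ₀ S' L P F ∧ (∀ s ≤ 0, F s = F₀ s) ∧
      ∀ s, S ≤ s → F s = F₂ s ∧ P s = 0 ∧ L s = ℓbar := by
  have hneg : -ℓ₀ ≤ 0 := by linarith
  have hL0 : 0 < L₀ 0 := hℓ₀.trans_le (W.le_front hneg)
  have hℓle : L₀ 0 ≤ ℓbar := by rcases hℓ with h | h <;> [exact h.2; exact h.le]
  have hκ0 : ∀ x ∈ Ici (0 : ℝ), 0 < κ x := fun x hx => hc₁.trans_le (hκ x hx)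
  have hk0 : 0 < κ (L₀ 0) := hκ0 _ hL0.le
  have hkb : 0 < κ ℓbar := hκ0 _ (hL0.le.trans hℓle)
  obtain ⟨p, hpc, hp0, hpm, hpr, hpl, hpI⟩ := exists_slope hS (W.slope_nonneg 0)
    (sub_nonneg.2 hℓle) (hℓ.imp And.left sub_pos.2)
  set P : ℝ → ℝ := fun s => if s ≤ 0 then P₀ s else p s with hP
  have hPc : Continuous P := W.continuous_slope.if_le hpc continuous_id continuous_const
    fun s hs => by rw [hs, hpm]
  have hPneg : ∀ s ≤ 0, P s = P₀ s := fun s hs => by simp [hP, hs]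
  have hPpos : ∀ s, 0 ≤ s → P s = p s := fun s hs => by
    rcases hs.eq_or_lt with rfl | hs
    · simp [hP, hpm]
    · simp [hP, not_le.2 hs]
  have hP0 : ∀ s, 0 ≤ P s := fun s => by
    rcases le_total s 0 with h | h
    · rw [hPneg s h]; exact W.slope_nonneg s
    · rw [hPpos s h]; exact hp0 s
  have hPS : ∀ s, S ≤ s → P s = 0 := fun s hs => by
    rw [hPpos s (by linarith)]; exact hpr s (by linarith)
  set L : ℝ → ℝ := fun s => L₀ 0 + ∫ r in (0 : ℝ)..s, P r with hL
  have hLd : ∀ s, HasDerivAt L (P s) s := fun s =>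
    (hasDerivAt_integral_of_continuous hPc 0 s).const_add _
  have hLc : Continuous L := continuous_iff_continuousAt.2 fun s => (hLd s).continuousAt
  have hLmono : Monotone L :=
    monotone_of_deriv_nonneg (fun s => (hLd s).differentiableAt) fun s => by
    rw [(hLd s).deriv]; exact hP0 s
  have hLneg : ∀ s ≤ 0, L s = L₀ s := by
    intro s hs
    have h1 : ∫ r in (0 : ℝ)..s, P r = ∫ r in (0 : ℝ)..s, P₀ r := by
      refine intervalIntegral.integral_congr fun r hr => ?_
      rw [uIcc_of_ge hs] at hr
      exact hPneg r hr.2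
    have h2 := intervalIntegral.integral_eq_sub_of_hasDerivAt (fun r _ => W.hasDerivAt r)
      (W.continuous_slope.intervalIntegrable 0 s)
    simp only [hL]
    rw [h1, h2, add_sub_cancel]
  have hLS : ∀ s, S ≤ s → L s = ℓbar := by
    intro s hs
    have h1 : ∫ r in (0 : ℝ)..S, P r = ∫ r in (0 : ℝ)..S, p r := by
      refine intervalIntegral.integral_congr fun r hr => ?_
      rw [uIcc_of_le hS.le] at hr
      exact hPpos r hr.1
    have h2 : ∫ r in S..s, P r = 0 := by
      rw [intervalIntegral.integral_congr (g := fun _ => (0 : ℝ)), intervalIntegral.integral_zero]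
      intro r hr
      rw [uIcc_of_le hs] at hr
      exact hPS r hr.1
    simp only [hL]
    rw [← intervalIntegral.integral_add_adjacent_intervals (b := S)
      (hPc.intervalIntegrable _ _) (hPc.intervalIntegrable _ _), h1, h2, hpI]
    ring
  have hLinit : L (-ℓ₀) = ℓ₀ := by rw [hLneg _ hneg, W.initial]
  have hLpos : ∀ s, -ℓ₀ ≤ s → 0 ≤ L s := fun s hs => by
    have := hLmono hs
    rw [hLinit] at this
    linarith
  -- the amplitude of the incoming derivative in the transition zone
  set R : ℝ → ℝ := fun s => √(κ (max (L s) 0) * (P s + 1 / 2)) with hR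
  have hRc : Continuous R := by
    have : Continuous fun s => κ (max (L s) 0) :=
      hκc.comp_continuous (by fun_prop) fun s => mem_Ici.2 (le_max_right _ _)
    exact (this.mul (hPc.add continuous_const)).sqrt
  have hR0 : R 0 = √(κ (L₀ 0) * (P₀ 0 + 1 / 2)) := by
    simp only [hR, hLneg 0 le_rfl, hPneg 0 le_rfl, max_eq_left hL0.le]
  have hR0pos : 0 < R 0 := by
    have := W.slope_nonneg 0
    rw [hR0]; positivity
  have hRS : R S = √(κ ℓbar * (0 + 1 / 2)) := by
    simp only [hR, hLS S le_rfl, hPS S le_rfl, max_eq_left (hL0.le.trans hℓle)]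
  have hRSpos : 0 < R S := by rw [hRS]; positivity
  have hev := W.evolution 0 ⟨hneg, le_rfl⟩
  have h0le : F₀ 0 ^ 2 ≤ κ (L₀ 0) * (P₀ 0 + 1 / 2) := by
    have h1 : F₀ 0 ^ 2 / κ (L₀ 0) - 1 / 2 ≤ P₀ 0 := by
      rw [hev]; exact le_max_left _ _
    have h2 : F₀ 0 ^ 2 / κ (L₀ 0) ≤ P₀ 0 + 1 / 2 := by linarith
    rw [div_le_iff₀ hk0] at h2
    linarith
  have hθ₀ : |F₀ 0 / R 0| ≤ 1 := by
    rw [abs_div, abs_of_pos hR0pos, div_le_one hR0pos, hR0]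
    exact Real.abs_le_sqrt h0le
  have hθ₀' : P₀ 0 ≠ 0 → |F₀ 0 / R 0| = 1 := by
    intro hne
    have h1 : P₀ 0 = F₀ 0 ^ 2 / κ (L₀ 0) - 1 / 2 := by
      rw [emissionSlope] at hev
      rcases max_choice (F₀ 0 ^ 2 / κ (L₀ 0) - 1 / 2) 0 with h | h <;> rw [h] at hev
      · exact hev
      · exact absurd hev hne
    have h2 : κ (L₀ 0) * (P₀ 0 + 1 / 2) = F₀ 0 ^ 2 := by
      rw [h1]; field_simp; ring
    rw [abs_div, abs_of_pos hR0pos, div_eq_one_iff_eq hR0pos.ne', hR0, h2, Real.sqrt_sq_eq_abs]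
  have hθ₁ : |F₂ S / R S| ≤ 1 := by
    rw [abs_div, abs_of_pos hRSpos, div_le_one hRSpos, hRS]
    refine Real.abs_le_sqrt ((hb S ⟨le_rfl, hSS'⟩).trans_eq ?_)
    ring
  -- If the initial branch ends at rest, P vanishes on the first third and τ is free to move to 1
  -- there. If it ends in motion, F₀ 0 / R 0 is already ±1 and τ keeps that sign until P has
  -- vanished.
  set θ : ℝ := if P₀ 0 = 0 then 1 else F₀ 0 / R 0 with hθ
  have hθabs : |θ| = 1 := by
    by_cases h : P₀ 0 = 0
    · simp [hθ, h]
    · rw [hθ, if_neg h]; exact hθ₀' h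
  obtain ⟨τ, hτc, hτ0, hτS, hτm, hτ1, hτl⟩ := exists_path hS hθ₀ hθabs.le hθ₁
  set F : ℝ → ℝ := fun s => if s ≤ 0 then F₀ s else if s ≤ S then τ s * R s else F₂ s with hF
  have hFc : Continuous F := by
    refine W.continuous_incoming.if_le (Continuous.if_le (hτc.mul hRc) hF₂ continuous_id
      continuous_const fun s hs => ?_) continuous_id continuous_const fun s hs => ?_
    · rw [hs, hτS, div_mul_cancel₀ _ hRSpos.ne']
    · rw [hs, if_pos hS.le, hτ0, div_mul_cancel₀ _ hR0pos.ne']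
  have hFneg : ∀ s ≤ 0, F s = F₀ s := fun s hs => by simp [hF, hs]
  have hFS : ∀ s, S ≤ s → F s = F₂ s := fun s hs => by
    have h0 : ¬ s ≤ 0 := by linarith
    rcases hs.eq_or_lt with rfl | hs
    · simp only [hF, if_neg h0, le_refl, if_true]
      rw [hτS, div_mul_cancel₀ _ hRSpos.ne']
    · simp [hF, h0, not_le.2 hs]
  refine ⟨L, P, F, ⟨hPc, hFc, hLd, hP0, hLinit, fun s hs => ?_⟩, hFneg, fun s hs =>
    ⟨hFS s hs, hPS s hs, hLS s hs⟩⟩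
  rcases le_or_gt s 0 with h0 | h0
  · rw [hPneg s h0, hFneg s h0, hLneg s h0]
    exact W.evolution s ⟨hs.1, h0⟩
  rcases le_or_gt s S with h1 | h1
  · have hFs : F s = τ s * R s := by simp [hF, not_le.2 h0, h1]
    rw [hFs]
    simp only [hR]
    rw [max_eq_left (hLpos s hs.1)]
    refine (emissionSlope_mul_sqrt (hκ0 _ (hLpos s hs.1)) (hP0 s) (hτ1 s) fun hne => ?_).symm
    rw [hPpos s h0.le] at hne
    have h2 : s ≤ 2 * S / 3 := by
      by_contra! hcon
      exact hne (hpr s hcon.le)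
    rcases le_total (S / 3) s with h3 | h3
    · rw [hτm s ⟨h3, h2⟩, hθabs]
    · have hm : P₀ 0 ≠ 0 := fun hm => hne (hpl hm s h3)
      rw [hτl (by rw [hθ, if_neg hm]) s h2, hθabs]
  · rw [hPS s h1.le, hFS s h1.le, hLS s h1.le, emissionSlope, max_eq_right]
    have := hb s ⟨h1.le, hs.2⟩
    rw [sub_nonpos, div_le_iff₀ hkb]
    linarith

/-! ### Reflection, the end of the initial branch, and the final data -/

/-- A front profile determines the derivative of the reflected wave. -/
lemma FrontProfile.exists_waveProfile {κ : ℝ → ℝ} {ℓ₀ S : ℝ} {L P F H₀ : ℝ → ℝ}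
    (W : FrontProfile κ ℓ₀ S L P F) (hH₀ : Continuous H₀)
    (hcompat : H₀ ℓ₀ * (1 + 2 * P (-ℓ₀)) = -F (-ℓ₀)) :
    ∃ H σ, WaveProfile κ ℓ₀ S L P F H σ ∧ ∀ x ≤ ℓ₀, H x = H₀ x := by
  obtain ⟨σ, hσ1, hσ2, -, hσd⟩ := exists_inverse_of_one_le_deriv
    (φ := fun s => s + L s) (φ' := fun s => 1 + P s)
    (fun s => (hasDerivAt_id s).add (W.hasDerivAt s)) fun s => by linarith [W.slope_nonneg s]
  -- The map ψ sends the phase t + x of the reflected wave to the emission coordinate of its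
  -- reflection.
  obtain ⟨ψ, hψ1, hψ2, hψm, hψd⟩ := exists_inverse_of_one_le_deriv
    (φ := fun s => s + 2 * L s) (φ' := fun s => 1 + 2 * P s)
    (fun s => (hasDerivAt_id s).add ((W.hasDerivAt s).const_mul 2)) fun s => by
      linarith [W.slope_nonneg s]
  have hψc : Continuous ψ := continuous_iff_continuousAt.2 fun x => (hψd x).continuousAt
  have hψ0 : ψ ℓ₀ = -ℓ₀ := by
    have := hψ2 (-ℓ₀)
    simp only [W.initial] at this
    rwa [show -ℓ₀ + 2 * ℓ₀ = ℓ₀ by ring] at this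
  have hpos : ∀ s, 0 < 1 + 2 * P s := fun s => by linarith [W.slope_nonneg s]
  set H : ℝ → ℝ := fun x => if x ≤ ℓ₀ then H₀ x else -F (ψ x) / (1 + 2 * P (ψ x)) with hH
  have hHl : ∀ x ≤ ℓ₀, H x = H₀ x := fun x hx => by simp [hH, hx]
  -- The compatibility of the data at the front is continuity of H across the phase ℓ₀.
  have hglue : H₀ ℓ₀ = -F (ψ ℓ₀) / (1 + 2 * P (ψ ℓ₀)) := by
    rw [hψ0, eq_div_iff (hpos _).ne', hcompat]
  have hHr : ∀ x, ℓ₀ ≤ x → H x = -F (ψ x) / (1 + 2 * P (ψ x)) := fun x hx => by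
    rcases hx.eq_or_lt with rfl | hx
    · rw [hHl _ le_rfl, hglue]
    · simp [hH, not_le.2 hx]
  have hHc : Continuous H := by
    have h1 := W.continuous_incoming.comp hψc
    have h2 := W.continuous_slope.comp hψc
    refine hH₀.if_le (h1.neg.div (continuous_const.add (continuous_const.mul h2)) fun x =>
      (hpos _).ne') continuous_id continuous_const fun x hx => ?_
    rw [hx, hglue]
  refine ⟨H, σ, { W with
    continuous_outgoing := hHc
    reflection := fun s hs => ?_
    emission_left_inv := hσ2
    emission_right_inv := hσ1
    hasDerivAt_emission := hσd }, hHl⟩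
  have hle : ℓ₀ ≤ s + 2 * L s := by linarith [W.le_front hs]
  rw [hHr _ hle, hψ2 s, div_mul_cancel₀ _ (hpos s).ne']

/-- The compatibility condition of the initial data, in terms of the derivatives of the incoming and
the outgoing wave. -/
lemma compat_of_griffithSpeed {a b k v w : ℝ} (hk : 0 < k)
    (h : v = -max ((1 / 2 * (v - w) ^ 2 - k) / (1 / 2 * (v - w) ^ 2 + k)) 0 * w)
    (ha : a = 1 / 2 * (v - w)) (hb : b = 1 / 2 * (v + w)) :
    b * (1 + 2 * emissionSlope a k) = -a := by
  have h1 : max ((1 / 2 * (v - w) ^ 2 - k) / (1 / 2 * (v - w) ^ 2 + k)) 0 = griffithSpeed a k := by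
    rw [griffithSpeed, ha]
    ring_nf
  rw [h1, griffithSpeed_eq_emissionSlope_div a hk] at h
  have h2 := emissionSlope_nonneg a k
  generalize emissionSlope a k = e at *
  have h3 : 0 < 1 + e := by linarith
  have h4 : v * (1 + e) = -e * w := by
    nth_rw 1 [h]; field_simp
  rw [hb, ha]
  linear_combination h4

/-- The existence and the values of the end of the initial branch. -/
lemma FrontProfile.isInitialBranchEnd_iff {κ : ℝ → ℝ} {c₁ ℓ₀ : ℝ} {L P F y₀ y₁ : ℝ → ℝ}
    (W : FrontProfile κ ℓ₀ 0 L P F) (hc₁ : 0 < c₁) (hℓ₀ : 0 < ℓ₀)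
    (hκ : ∀ x ∈ Ici (0 : ℝ), c₁ ≤ κ x) (hκ_lip : LocallyLipschitzOn (Ici (0 : ℝ)) κ)
    (hF : ∀ s ∈ Icc (-ℓ₀) 0, F s = incoming ℓ₀ y₀ y₁ s) (tS ℓS dS : ℝ) :
    IsInitialBranchEnd κ ℓ₀ y₀ y₁ tS ℓS dS ↔
      tS = L 0 ∧ ℓS = L 0 ∧ dS = griffithSpeed (F 0) (κ (L 0)) := by
  have hκ0 : ∀ x ∈ Ici (0 : ℝ), 0 < κ x := fun x hx => hc₁.trans_le (hκ x hx)
  have hneg : -ℓ₀ ≤ 0 := by linarith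
  have hL0 : 0 < L 0 := hℓ₀.trans_le (W.le_front hneg)
  have h00 : F 0 = incoming ℓ₀ y₀ y₁ 0 := hF 0 ⟨hneg, le_rfl⟩
  constructor
  · rintro ⟨lam, ⟨hpos, hreg, hinit, hevol, hterm⟩, rfl, rfl⟩
    have hd : ∀ t ∈ Icc 0 tS, HasDerivWithinAt lam
        (griffithSpeed (incoming ℓ₀ y₀ y₁ (t - lam t)) (κ (lam t))) (Icc 0 tS) t := fun t ht => by
      rw [← hevol t ht]
      exact (hreg.differentiableOn (by simp) t ht).hasDerivWithinAt
    obtain ⟨-, hmono⟩ := monotoneOn_of_griffithSpeed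
      (a := fun t => incoming ℓ₀ y₀ y₁ (t - lam t)) hκ0 hpos.le (hinit.symm ▸ hℓ₀.le) hd
    have hmem : ∀ t ∈ Icc 0 tS, t - lam t ∈ Icc (-ℓ₀) 0 := fun t ht => by
      have h1 := hmono (left_mem_Icc.2 hpos.le) ht ht.1
      have h2 := hmono ht (right_mem_Icc.2 hpos.le) ht.2
      simp only [hinit] at h1 h2
      exact ⟨by linarith, by linarith⟩
    have hd' : ∀ t ∈ Icc 0 tS, HasDerivWithinAt lam
        (griffithSpeed (F (t - lam t)) (κ (lam t))) (Icc 0 tS) t := fun t ht => by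
      rw [hF _ (hmem t ht)]
      exact hd t ht
    -- At the end of the branch s = 0, so the position there is L 0, and tS equals the position.
    have hend := W.eq_of_griffithSpeed hℓ₀ hc₁ hκ hκ_lip hpos.le hinit hd' hterm.le
      (right_mem_Icc.2 hpos.le)
    rw [hterm] at hend
    refine ⟨by linarith, hend, ?_⟩
    rw [hevol tS (right_mem_Icc.2 hpos.le), hterm, hend, h00]
  · rintro ⟨rfl, rfl, rfl⟩
    obtain ⟨σ, hσ1, hσ2, hσm, hσd⟩ := exists_inverse_of_one_le_deriv
      (φ := fun s => s + L s) (φ' := fun s => 1 + P s)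
      (fun s => (hasDerivAt_id s).add (W.hasDerivAt s)) fun s => by linarith [W.slope_nonneg s]
    have hσ0 : σ 0 = -ℓ₀ := by
      have := hσ2 (-ℓ₀)
      simpa [W.initial] using this
    have hσL : σ (L 0) = 0 := by simpa using hσ2 0
    have hmem : ∀ t ∈ Icc 0 (L 0), σ t ∈ Icc (-ℓ₀) 0 := fun t ht =>
      ⟨hσ0 ▸ hσm.monotone ht.1, hσL ▸ hσm.monotone ht.2⟩
    have hlam : ∀ t, HasDerivAt (fun t => L (σ t)) (P (σ t) / (1 + P (σ t))) t := fun t => by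
      simpa [div_eq_mul_inv, Function.comp_def] using (W.hasDerivAt (σ t)).comp t (hσd t)
    have hσc : Continuous σ := continuous_iff_continuousAt.2 fun t => (hσd t).continuousAt
    have hevol : ∀ t ∈ Icc 0 (L 0), derivWithin (fun t => L (σ t)) (Icc 0 (L 0)) t =
        griffithSpeed (F (σ t)) (κ (L (σ t))) := fun t ht => by
      rw [(hlam t).hasDerivWithinAt.derivWithin (uniqueDiffOn_Icc hL0 t ht),
        griffithSpeed_eq_emissionSlope_div _
          (hκ0 _ (hℓ₀.le.trans (W.le_front (hmem t ht).1))), ← W.evolution _ (hmem t ht)]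
    refine ⟨fun t => L (σ t), ⟨hL0, ?_, by simp [hσ0, W.initial], fun t ht => ?_, by simp [hσL]⟩,
      by simp [hσL], ?_⟩
    · refine ContDiff.contDiffOn (contDiff_one_iff_deriv.2
        ⟨fun t => (hlam t).differentiableAt, ?_⟩)
      rw [show deriv (fun t => L (σ t)) = _ from funext fun t => (hlam t).deriv]
      have h1 := W.continuous_slope.comp hσc
      refine h1.div (continuous_const.add h1) fun t => ?_
      have := W.slope_nonneg (σ t)
      positivity
    · rw [hevol t ht, show t - L (σ t) = σ t by linarith [hσ1 t], hF _ (hmem t ht)]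
    · rw [hevol _ (right_mem_Icc.2 hL0.le), hσL]

/-- The essential bound of a continuous function on an interval holds everywhere. -/
lemma sq_le_of_eLpNorm_top_le {f : ℝ → ℝ} {b k : ℝ} (hb : 0 < b) (hk : 0 ≤ k)
    (hf : ContinuousOn f (Icc 0 b))
    (h : eLpNorm f ∞ (volume.restrict (Icc 0 b)) ^ 2 ≤ ENNReal.ofReal k) {x : ℝ}
    (hx : x ∈ Icc 0 b) : f x ^ 2 ≤ k := by
  rw [eLpNorm_exponent_top] at h
  -- An almost everywhere inequality is recast as an equality of continuous functions, which then
  -- holds on the whole interval.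
  have hae : (fun x => max (f x ^ 2) k) =ᵐ[volume.restrict (Icc 0 b)] fun _ => k := by
    filter_upwards [enorm_ae_le_eLpNormEssSup f (volume.restrict (Icc 0 b))] with x hx
    refine max_eq_right ?_
    have h1 : ‖f x‖ₑ ^ 2 ≤ ENNReal.ofReal k := (pow_le_pow_left' hx 2).trans h
    rw [Real.enorm_eq_ofReal_abs, ← ENNReal.ofReal_pow (abs_nonneg _), sq_abs,
      ENNReal.ofReal_le_ofReal_iff hk] at h1
    exact h1
  have hEq := Measure.eqOn_Icc_of_ae_eq volume hb.ne hae
    (ContinuousOn.sup (hf.pow 2) continuousOn_const)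
    continuousOn_const hx
  exact (le_max_left _ _).trans_eq hEq

/-- The displacement of a wave profile whose front has come to rest at `ℓbar` realizes prescribed
final data. -/
lemma WaveProfile.displacement_final {κ : ℝ → ℝ} {ℓ₀ S T ℓbar : ℝ} {L P F H σ : ℝ → ℝ}
    {ybar₀ ybar₁ : ℝ → ℝ} (W : WaveProfile κ ℓ₀ S L P F H σ) (hT : 0 < T) (hℓ₀ : 0 < ℓ₀)
    (hℓbar : 0 < ℓbar) (hTℓ : 2 * ℓbar < T) (hL : ∀ s, T - 2 * ℓbar ≤ s → L s = ℓbar)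
    (hP : ∀ s, T - 2 * ℓbar ≤ s → P s = 0)
    (hFl : ∀ x ∈ Icc 0 ℓbar, F (T - 2 * ℓbar + x) =
      -(1 / 2 * (ybar₁ x + derivWithin ybar₀ (Icc 0 ℓbar) x)))
    (hFr : ∀ x ∈ Icc 0 ℓbar, F (T - x) = 1 / 2 * (ybar₁ x - derivWithin ybar₀ (Icc 0 ℓbar) x))
    (hybar₀ : ContDiffOn ℝ 1 ybar₀ (Icc 0 ℓbar)) (hybar₀' : ybar₀ ℓbar = 0) :
    L (σ T) = ℓbar ∧ (∀ x ∈ Icc 0 ℓbar, displacement ℓ₀ F H (T, x) = ybar₀ x) ∧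
      ∀ x ∈ Icc 0 ℓbar, dt T (fun t => L (σ t)) (displacement ℓ₀ F H) (T, x) = ybar₁ x := by
  have hσT : σ T = T - ℓbar := by
    have := W.emission_left_inv (T - ℓbar)
    rwa [hL _ (by linarith), sub_add_cancel] at this
  have hLT : L (σ T) = ℓbar := by rw [hσT]; exact hL _ (by linarith)
  -- At a resting front the reflection law is H(s + 2ℓbar) = -F(s).
  have hH : ∀ x ∈ Icc 0 ℓbar, H (T + x) = 1 / 2 * (ybar₁ x + derivWithin ybar₀ (Icc 0 ℓbar) x) := by
    intro x hx
    have h1 : T - 2 * ℓbar ≤ T - 2 * ℓbar + x := by linarith [hx.1]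
    have h2 := W.reflection (T - 2 * ℓbar + x) (by linarith [hx.1])
    rw [hL _ h1, hP _ h1, hFl x hx, show T - 2 * ℓbar + x + 2 * ℓbar = T + x by ring] at h2
    linarith
  refine ⟨hLT, fun x hx => ?_, fun x hx => ?_⟩
  · have hd : ∀ z ∈ Icc 0 ℓbar, HasDerivWithinAt
        (fun z => displacement ℓ₀ F H (T, z) - ybar₀ z) 0 (Icc 0 ℓbar) z := by
      intro z hz
      have h1 := (hasFDerivAt_displacement (ℓ₀ := ℓ₀) W.continuous_incoming W.continuous_outgoing
        (T, z)).comp_hasDerivAt z ((hasDerivAt_const z T).prodMk (hasDerivAt_id z))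
      refine (h1.hasDerivWithinAt.fun_sub
        (hybar₀.differentiableOn (by simp) z hz).hasDerivWithinAt).congr_deriv ?_
      have e1 := hH z hz
      have e2 := hFr z hz
      simp
      linarith
    have hconst := constant_of_has_deriv_right_zero
      (fun z hz => (hd z hz).continuousWithinAt) fun z hz =>
        (hd z (Ico_subset_Icc_self hz)).mono_of_mem_nhdsWithin (Icc_mem_nhdsGE_of_mem hz)
    have hx' := hconst x hx
    have hend := hconst ℓbar ⟨hℓbar.le, le_rfl⟩
    have hzero := W.displacement_front hT.le
    rw [hLT] at hzero
    rw [hzero, hybar₀'] at hend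
    linarith
  · rw [(fderivWithin_displacement W.continuous_incoming W.continuous_outgoing
      (W.uniqueDiffOn hT hℓ₀) ⟨hT.le, le_rfl, hx.1, by simpa [hLT] using hx.2⟩).1]
    simp only
    rw [hFr x hx, hH x hx]
    ring

/-- The incoming derivative that produces prescribed final data when the front rests at `ℓbar`. -/
lemma exists_final_incoming {T ℓbar : ℝ} (hℓbar : 0 < ℓbar) {ybar₀ ybar₁ : ℝ → ℝ}
    (hybar₀ : ContDiffOn ℝ 1 ybar₀ (Icc 0 ℓbar)) (hybar₁ : ContinuousOn ybar₁ (Icc 0 ℓbar))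
    (hybar₁' : ybar₁ ℓbar = 0) :
    ∃ F : ℝ → ℝ, Continuous F ∧
      (∀ x ∈ Icc 0 ℓbar, F (T - 2 * ℓbar + x) =
        -(1 / 2 * (ybar₁ x + derivWithin ybar₀ (Icc 0 ℓbar) x))) ∧
      ∀ x ∈ Icc 0 ℓbar, F (T - x) = 1 / 2 * (ybar₁ x - derivWithin ybar₀ (Icc 0 ℓbar) x) := by
  have hd := hybar₀.continuousOn_derivWithin (uniqueDiffOn_Icc hℓbar) le_rfl
  obtain ⟨A, hA, hAe⟩ := exists_continuous_eqOn_Icc hℓbar.le (hybar₁.add hd)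
  obtain ⟨B, hB, hBe⟩ := exists_continuous_eqOn_Icc hℓbar.le (hybar₁.sub hd)
  -- The two prescriptions meet at s = T - ℓbar, where they agree because the final velocity
  -- vanishes at ℓbar.
  have hend : -(1 / 2 * A ℓbar) = 1 / 2 * B ℓbar := by
    rw [hAe ⟨hℓbar.le, le_rfl⟩, hBe ⟨hℓbar.le, le_rfl⟩]
    simp [hybar₁']
  refine ⟨fun s => if s ≤ T - ℓbar then -(1 / 2 * A (s - (T - 2 * ℓbar))) else 1 / 2 * B (T - s),
    Continuous.if_le (by fun_prop) (by fun_prop) continuous_id continuous_const fun s hs => ?_,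
    fun x hx => ?_, fun x hx => ?_⟩
  · rw [hs, show T - ℓbar - (T - 2 * ℓbar) = ℓbar by ring, sub_sub_cancel, hend]
  · have h1 : T - 2 * ℓbar + x ≤ T - ℓbar := by linarith [hx.2]
    simp only [h1, if_true, add_sub_cancel_left]
    rw [hAe hx]
    rfl
  · rcases hx.2.eq_or_lt with rfl | hlt
    · simp only [le_refl, if_true]
      rw [show T - x - (T - 2 * x) = x by ring, hend, hBe hx]
      rfl
    · have h1 : ¬ T - x ≤ T - ℓbar := by linarith
      simp only [h1, if_false, sub_sub_cancel]
      rw [hBe hx]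
      rfl

end Debonding

/-! ### The controllability theorem -/

theorem mainTheorem4
    -- the toughness
    (κ : ℝ → ℝ) (c₁ c₂ : ℝ) (hc₁ : 0 < c₁) (hc₂ : c₁ < c₂)
    (hκ : ∀ x ∈ Ici (0 : ℝ), κ x ∈ Icc c₁ c₂) (hκ_lip : LocallyLipschitzOn (Ici (0 : ℝ)) κ)
    -- the initial data and their compatibility
    (ℓ₀ : ℝ) (hℓ₀ : 0 < ℓ₀) (y₀ y₁ : ℝ → ℝ)
    (hy₀ : ContDiffOn ℝ 1 y₀ (Icc 0 ℓ₀)) (hy₁ : ContinuousOn y₁ (Icc 0 ℓ₀))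
    (hcompat₀ : y₀ ℓ₀ = 0)
    (hcompat₁ : y₁ ℓ₀ =
      -max ((1 / 2 * (y₁ ℓ₀ - derivWithin y₀ (Icc 0 ℓ₀) ℓ₀) ^ 2 - κ ℓ₀) /
          (1 / 2 * (y₁ ℓ₀ - derivWithin y₀ (Icc 0 ℓ₀) ℓ₀) ^ 2 + κ ℓ₀)) 0
        * derivWithin y₀ (Icc 0 ℓ₀) ℓ₀) :
    -- the end of the initial branch is well defined
    (∃! q : ℝ × ℝ × ℝ, Debonding.IsInitialBranchEnd κ ℓ₀ y₀ y₁ q.1 q.2.1 q.2.2) ∧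
    ∀ tS ℓS dS : ℝ, Debonding.IsInitialBranchEnd κ ℓ₀ y₀ y₁ tS ℓS dS →
    -- the final time and the final data
    ∀ (T ℓbar : ℝ) (ybar₀ ybar₁ : ℝ → ℝ), 0 < T → 0 < ℓbar →
      ContDiffOn ℝ 1 ybar₀ (Icc 0 ℓbar) → ContinuousOn ybar₁ (Icc 0 ℓbar) →
      ((dS = 0 ∧ ℓS ≤ ℓbar) ∨ (dS ≠ 0 ∧ ℓS < ℓbar)) →
      2 * ℓbar < T →
      ybar₀ ℓbar = 0 → ybar₁ ℓbar = 0 →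
      eLpNorm (fun x => ybar₁ x + derivWithin ybar₀ (Icc 0 ℓbar) x) ∞
          (volume.restrict (Icc 0 ℓbar)) ^ 2 ≤ ENNReal.ofReal (2 * κ ℓbar) →
    -- a control, and the solution it generates
    ∃ u : ℝ → ℝ, ContDiffOn ℝ 1 u (Icc 0 T) ∧
      ∃ (ℓ : ℝ → ℝ) (y : ℝ × ℝ → ℝ),
        Debonding.IsC1Solution κ T ℓ₀ y₀ y₁ u ℓ y ∧
        (∀ (ℓ' : ℝ → ℝ) (y' : ℝ × ℝ → ℝ), Debonding.IsC1Solution κ T ℓ₀ y₀ y₁ u ℓ' y' →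
          EqOn ℓ' ℓ (Icc 0 T) ∧ EqOn y' y (Debonding.closedRegion T ℓ)) ∧
        ℓ T = ℓbar ∧
        (∀ x ∈ Icc 0 ℓbar, y (T, x) = ybar₀ x) ∧
        (∀ x ∈ Icc 0 ℓbar, Debonding.dt T ℓ y (T, x) = ybar₁ x) := by
  have hκ₁ : ∀ x ∈ Ici (0 : ℝ), c₁ ≤ κ x := fun x hx => (hκ x hx).1
  have hκ₀ : ∀ x ∈ Ici (0 : ℝ), 0 < κ x := fun x hx => hc₁.trans_le (hκ₁ x hx)
  have hdy₀ := hy₀.continuousOn_derivWithin (uniqueDiffOn_Icc hℓ₀) le_rfl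
  have hneg : ∀ s ∈ Icc (-ℓ₀) 0, -s ∈ Icc 0 ℓ₀ := fun s hs =>
    ⟨by linarith [hs.2], by linarith [hs.1]⟩
  obtain ⟨F₀, hF₀, hF₀e⟩ := Debonding.exists_continuous_eqOn_Icc (by linarith : -ℓ₀ ≤ 0)
    (f := Debonding.incoming ℓ₀ y₀ y₁)
    (continuousOn_const.mul ((hy₁.comp continuousOn_neg hneg).sub
      (hdy₀.comp continuousOn_neg hneg)))
  obtain ⟨H₀, hH₀, hH₀e⟩ := Debonding.exists_continuous_eqOn_Icc hℓ₀.le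
    (f := fun x => 1 / 2 * (y₁ x + derivWithin y₀ (Icc 0 ℓ₀) x))
    (continuousOn_const.mul (hy₁.add hdy₀))
  obtain ⟨L₀, P₀, W₀⟩ := Debonding.exists_initial_profile hc₁ hℓ₀ hκ₁ hκ_lip hF₀
  have hbranch := W₀.isInitialBranchEnd_iff hc₁ hℓ₀ hκ₁ hκ_lip (fun s hs => hF₀e hs)
  refine ⟨⟨(L₀ 0, L₀ 0, Debonding.griffithSpeed (F₀ 0) (κ (L₀ 0))),
    (hbranch _ _ _).2 ⟨rfl, rfl, rfl⟩, ?_⟩, ?_⟩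
  · rintro ⟨a, b, c⟩ hq
    obtain ⟨h1, h2, h3⟩ := (hbranch _ _ _).1 hq
    simp only at h1 h2 h3
    rw [h1, h2, h3]
  intro tS ℓS dS hend T ℓbar ybar₀ ybar₁ hT hℓbar hybar₀ hybar₁ hℓ hTℓ hybar₀' hybar₁' hnorm
  obtain ⟨-, rfl, rfl⟩ := (hbranch _ _ _).1 hend
  have hκb := hκ₀ ℓbar hℓbar.le
  obtain ⟨F₂, hF₂, hF₂l, hF₂r⟩ :=
    Debonding.exists_final_incoming (T := T) hℓbar hybar₀ hybar₁ hybar₁'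
  -- Here F₂ is minus half of ybar₁ + ybar₀', so the bound 2κ(ℓbar) on the square of the latter
  -- becomes κ(ℓbar)/2.
  have hF₂b : ∀ s ∈ Icc (T - 2 * ℓbar) (T - ℓbar), F₂ s ^ 2 ≤ κ ℓbar / 2 := by
    intro s hs
    have hx : s - (T - 2 * ℓbar) ∈ Icc 0 ℓbar := ⟨by linarith [hs.1], by linarith [hs.2]⟩
    have h1 := Debonding.sq_le_of_eLpNorm_top_le hℓbar (by positivity) (hybar₁.add
      (hybar₀.continuousOn_derivWithin (uniqueDiffOn_Icc hℓbar) le_rfl)) hnorm hx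
    have h2 := hF₂l _ hx
    rw [Pi.add_apply] at h1
    rw [add_sub_cancel] at h2
    rw [h2]
    linarith
  have hℓ' : P₀ 0 = 0 ∧ L₀ 0 ≤ ℓbar ∨ L₀ 0 < ℓbar := by
    refine hℓ.imp (fun h => ⟨?_, h.2⟩) And.right
    have h0 : (0 : ℝ) ∈ Icc (-ℓ₀) 0 := ⟨by linarith, le_rfl⟩
    have h1 := h.1
    have h2 := W₀.slope_nonneg 0
    rw [Debonding.griffithSpeed_eq_emissionSlope_div _
      (hκ₀ _ (hℓ₀.le.trans (W₀.le_front h0.1))), ← W₀.evolution 0 h0,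
      div_eq_zero_iff] at h1
    rcases h1 with h1 | h1 <;> linarith
  -- The transition zone is [0, T - 2ℓbar]. Griffith's law is needed only up to T - ℓbar, because
  -- later emissions have not reached the front at time T.
  obtain ⟨L, P, F, W, hFneg, hafter⟩ := W₀.exists_extension hc₁ hℓ₀ hκ₁ hκ_lip.continuousOn
    (sub_pos.2 hTℓ) (by linarith) hℓ' hF₂ hF₂b
  have hF : ∀ s ∈ Icc (-ℓ₀) 0, F s = Debonding.incoming ℓ₀ y₀ y₁ s := fun s hs =>
    (hFneg s hs.2).trans (hF₀e hs)
  obtain ⟨H, σ, V, hHe⟩ := W.exists_waveProfile hH₀ (by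
    have hm : -ℓ₀ ∈ Icc (-ℓ₀) (T - ℓbar) := ⟨le_rfl, by linarith⟩
    rw [W.evolution _ hm, W.initial]
    refine Debonding.compat_of_griffithSpeed (hκ₀ _ hℓ₀.le) hcompat₁ ?_
      (hH₀e ⟨hℓ₀.le, le_rfl⟩)
    rw [hF _ ⟨le_rfl, by linarith⟩, Debonding.incoming, neg_neg])
  have hH : ∀ x ∈ Icc 0 ℓ₀, H x = 1 / 2 * (y₁ x + derivWithin y₀ (Icc 0 ℓ₀) x) := fun x hx =>
    (hHe x hx.2).trans (hH₀e hx)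
  have hσT : σ T ≤ T - ℓbar := by
    have := V.emission_left_inv (T - ℓbar)
    rw [(hafter (T - ℓbar) (by linarith)).2.2, sub_add_cancel] at this
    exact this.le
  refine ⟨fun t => Debonding.displacement ℓ₀ F H (t, 0), ?_, fun t => L (σ t),
    Debonding.displacement ℓ₀ F H, V.isC1Solution hκ₀ hT hℓ₀ hσT hF hH hy₀ hcompat₀,
    fun ℓ' y' h => V.unique hc₁ hκ₁ hκ_lip hT hℓ₀ hσT hF hH h,
    V.displacement_final hT hℓ₀ hℓbar hTℓ (fun s hs => (hafter s hs).2.2)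
      (fun s hs => (hafter s hs).2.1) (fun x hx => ?_) (fun x hx => ?_) hybar₀ hybar₀'⟩
  · exact ((Debonding.contDiff_displacement V.continuous_incoming V.continuous_outgoing).comp
      (contDiff_id.prodMk contDiff_const)).contDiffOn
  · rw [(hafter _ (by linarith [hx.1])).1, hF₂l x hx]
  · rw [(hafter _ (by linarith [hx.2])).1, hF₂r x hx]
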